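/- Let $\mathscr H$ be a complex Hilbert space and $0<p<\infty$. Let $\mathbb B_p(\mathscr H)$ be the set of compact operators $X$ on $\mathscr H$ whose singular values $s_n(X)$ satisfy $\sum_n s_n(X)^p<\infty$; write $|X|=(X^*X)^{1/2}$, and $A\le B$ if $B-A$ is positive semidefinite. Let $X_1,\dots,X_s,Y_1,\dots,Y_t\in\mathbb B_p(\mathscr H)$ satisfy $$\sum_{i=1}^s|X_i|^2=\sum_{j=1}^t|Y_j|^2 .$$ (a) If $p\ge 2$, there are partial isometries $U_1,\dots,U_s$ and $V_1,\dots,V_t$ on $\mathscr H$, each $U_i$ isometric on $(\ker X_i)^\perp$ and each $V_j$ isometric on $(\ker Y_j)^\perp$ (that is, $(\ker X_i)^\perp$ and $(\ker Y_j)^\perp$ are contained in the initial spaces of $U_i$ and $V_j$ respectively), such that $$\sum_{i=1}^sU_i|X_i|^pU_i^*\le t^{\frac p2-1}\sum_{j=1}^t|Y_j|^p,\qquad \sum_{j=1}^tV_j|Y_j|^pV_j^*\le s^{\frac p2-1}\sum_{i=1}^s|X_i|^p .$$ If $\mathscr H$ is finite-dimensional, all $U_i$ and $V_j$ can moreover be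 chosen to be isometries, i.e. unitaries. (b) If $0<p\le 2$, there are isometries $U_1,\dots,U_s$ and $V_1,\dots,V_t$ on $\mathscr H$ such that $$\sum_{i=1}^sU_i|X_i|^pU_i^*\ge t^{\frac p2-1}\sum_{j=1}^t|Y_j|^p,\qquad \sum_{j=1}^tV_j|Y_j|^pV_j^*\ge s^{\frac p2-1}\sum_{i=1}^s|X_i|^p .$$ -/

import Mathlib

noncomputable section

/-- The `n`-th singular value `s_n(X)` (indexed from `0`) of a bounded operator `X` on a Hilbert
space, as the distance from `X` to the operators of rank at most `n`. For compact `X` these are the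
eigenvalues of `|X|` in decreasing order, counted with multiplicity. -/
def opSingularValue {H : Type*} [NormedAddCommGroup H] [InnerProductSpace ℂ H]
    (X : H →L[ℂ] H) (n : ℕ) : ℝ :=
  sInf {r : ℝ | ∃ F : H →L[ℂ] H, LinearMap.rank (F : H →ₗ[ℂ] H) ≤ (n : Cardinal) ∧ r = ‖X - F‖}

/-- The Schatten class `𝔹_p(H)`, for real `p > 0`: the compact operators whose singular values
satisfy `∑ s_n(X) ^ p < ∞`. -/
def IsSchatten {H : Type*} [NormedAddCommGroup H] [InnerProductSpace ℂ H]
    (p : ℝ) (X : H →L[ℂ] H) : Prop :=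
  IsCompactOperator X ∧ Summable (fun n : ℕ => opSingularValue X n ^ p)

/-- `U` is an isometry: `U* U = 1`. -/
def IsIsometryOp {H : Type*} [NormedAddCommGroup H] [InnerProductSpace ℂ H] [CompleteSpace H]
    (U : H →L[ℂ] H) : Prop :=
  star U * U = 1

/-- `U` is a partial isometry, `U U* U = U`, i.e. it is isometric on its initial space
`(ker U)ᗮ`. -/
def IsPartialIsometryOp {H : Type*} [NormedAddCommGroup H] [InnerProductSpace ℂ H]
    [CompleteSpace H] (U : H →L[ℂ] H) : Prop :=
  U * star U * U = U

/-- `U` is a partial isometry which is isometric on the support `(ker X)ᗮ` of `X`: its initial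
space `(ker U)ᗮ` contains `(ker X)ᗮ`. On a finite-dimensional space `U` is moreover required to be
isometric everywhere, hence unitary. -/
def IsIsometricOnSupport {H : Type*} [NormedAddCommGroup H] [InnerProductSpace ℂ H]
    [CompleteSpace H] (U X : H →L[ℂ] H) : Prop :=
  IsPartialIsometryOp U ∧
    LinearMap.ker (U : H →ₗ[ℂ] H) ≤ LinearMap.ker (X : H →ₗ[ℂ] H) ∧
    (FiniteDimensional ℂ H → IsIsometryOp U)

/-- `|X| ^ p`, where `|X| = (X* X) ^ (1/2)`, by continuous functional calculus. -/
def absPow {H : Type*} [NormedAddCommGroup H] [InnerProductSpace ℂ H] [CompleteSpace H]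
    (X : H →L[ℂ] H) (p : ℝ) : H →L[ℂ] H :=
  CFC.abs X ^ p

end

/-! Put r = p/2, A_i = |X_i|², B_j = |Y_j|² and S = ∑ A_i = ∑ B_j, so that |X_i|^p = A_i^r and
|Y_j|^p = B_j^r. Each half compares ∑ B_j^r with S^r, and S^r with conjugates of the A_i^r.

The link with the A_i is common to both halves (`exists_contractions_of_sum`). Douglas factorization
gives contractions with A_i^(1/2) = C_i S^(1/2), and ∑ C_i* C_i is the identity on the support of S.
Hence S^r = ∑ T_i T_i* with T_i = S^(r/2) C_i*. Polar decomposition turns T_i T_i* into T_i* T_i =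
C_i S^r C_i*, which is to be compared with A_i^r = (C_i S C_i*)^r.

For r ≤ 1, Hansen's inequality gives C_i S^r C_i* ≤ A_i^r, and operator concavity gives t^(r-1) ∑
B_j^r ≤ S^r. To make the conjugating operators true isometries, ker T_i is embedded into ker T_i*;
compactness plays no role.

For r ≥ 1 operator convexity may fail, but ⟨By, y⟩^r ≤ ⟨B^r y, y⟩ for ‖y‖ ≤ 1 survives. Through the
min-max principle such a bound on quadratic forms compares eigenvalues, hence yields an operator
inequality after conjugation by a partial isometry (`exists_partialIsometry_conj_rpow_le`). It is
applied to A_i against C_i S^r C_i*, and to S against M = t^(r-1) ∑ B_j^r. The resulting partial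
isometries are composed with the polar ones. In finite dimension they extend to unitaries. -/

open ContinuousLinearMap
open scoped InnerProductSpace

/-! ### Quadratic forms and the operator order. -/

section QuadraticForm

variable {H : Type*} [NormedAddCommGroup H] [InnerProductSpace ℂ H]

theorem mul_apply_eq (A B : H →L[ℂ] H) (x : H) : (A * B) x = A (B x) := rfl

theorem reApplyInnerSelf_add (A B : H →L[ℂ] H) (x : H) :
    (A + B).reApplyInnerSelf x = A.reApplyInnerSelf x + B.reApplyInnerSelf x := by
  simp [reApplyInnerSelf_apply, inner_add_left]

theorem reApplyInnerSelf_sum {ι : Type*} (s : Finset ι) (A : ι → H →L[ℂ] H) (x : H) :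
    (∑ i ∈ s, A i).reApplyInnerSelf x = ∑ i ∈ s, (A i).reApplyInnerSelf x := by
  simp [reApplyInnerSelf_apply, sum_inner]

theorem reApplyInnerSelf_real_smul (c : ℝ) (A : H →L[ℂ] H) (x : H) :
    (c • A).reApplyInnerSelf x = c * A.reApplyInnerSelf x := by
  simp [reApplyInnerSelf_apply, inner_smul_left_eq_smul]

theorem reApplyInnerSelf_one (x : H) : (1 : H →L[ℂ] H).reApplyInnerSelf x = ‖x‖ ^ 2 := by
  simp [reApplyInnerSelf_apply, ← Complex.ofReal_pow]

theorem reApplyInnerSelf_mono {A B : H →L[ℂ] H} (h : A ≤ B) (x : H) :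
    A.reApplyInnerSelf x ≤ B.reApplyInnerSelf x := by
  have := ((ContinuousLinearMap.le_def A B).1 h).2 x
  simpa [reApplyInnerSelf_apply, inner_sub_left] using this

theorem reApplyInnerSelf_nonneg {A : H →L[ℂ] H} (h : 0 ≤ A) (x : H) :
    0 ≤ A.reApplyInnerSelf x := by
  simpa [reApplyInnerSelf_apply] using reApplyInnerSelf_mono h x

variable [CompleteSpace H]

theorem reApplyInnerSelf_star_mul_self (T : H →L[ℂ] H) (x : H) :
    (star T * T).reApplyInnerSelf x = ‖T x‖ ^ 2 := by
  simp [reApplyInnerSelf_apply, star_eq_adjoint, adjoint_inner_left, ← Complex.ofReal_pow]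

theorem reApplyInnerSelf_conj (C A : H →L[ℂ] H) (x : H) :
    (C * A * star C).reApplyInnerSelf x = A.reApplyInnerSelf (star C x) := by
  simp [reApplyInnerSelf_apply, star_eq_adjoint, adjoint_inner_right]

theorem le_of_reApplyInnerSelf_le {A B : H →L[ℂ] H} (hA : IsSelfAdjoint A) (hB : IsSelfAdjoint B)
    (h : ∀ x, A.reApplyInnerSelf x ≤ B.reApplyInnerSelf x) : A ≤ B := by
  rw [ContinuousLinearMap.le_def]
  refine isPositive_def'.2 ⟨hB.sub hA, fun x => ?_⟩
  simpa [reApplyInnerSelf_apply, inner_sub_left] using h x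

theorem norm_eq_of_star_mul_self_eq {S R : H →L[ℂ] H} (h : star S * S = star R * R) (x : H) :
    ‖S x‖ = ‖R x‖ := by
  have := reApplyInnerSelf_star_mul_self S x
  rw [h, reApplyInnerSelf_star_mul_self] at this
  exact ((sq_eq_sq₀ (norm_nonneg _) (norm_nonneg _)).1 this).symm

/-- If `Q ≥ 0` and `R* Q R = 0`, then `Q R = 0`. -/
theorem mul_eq_zero_of_star_mul_mul_eq_zero {Q R : H →L[ℂ] H} (hQ : 0 ≤ Q)
    (h : star R * Q * R = 0) : Q * R = 0 := by
  have hs : IsSelfAdjoint (CFC.sqrt Q) := (CFC.sqrt_nonneg Q).isSelfAdjoint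
  have h1 : star (CFC.sqrt Q * R) * (CFC.sqrt Q * R) = 0 := by
    rw [star_mul, hs.star_eq, ← h]
    nth_rw 3 [← CFC.sqrt_mul_sqrt_self Q]
    simp only [mul_assoc]
  rw [CStarRing.star_mul_self_eq_zero_iff] at h1
  rw [← CFC.sqrt_mul_sqrt_self Q, mul_assoc, h1, mul_zero]

theorem apply_eq_zero_of_reApplyInnerSelf_eq_zero {Q : H →L[ℂ] H} (hQ : 0 ≤ Q) {x : H}
    (h : Q.reApplyInnerSelf x = 0) : Q x = 0 := by
  have hs : IsSelfAdjoint (CFC.sqrt Q) := (CFC.sqrt_nonneg Q).isSelfAdjoint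
  have h1 := reApplyInnerSelf_star_mul_self (CFC.sqrt Q) x
  rw [hs.star_eq, CFC.sqrt_mul_sqrt_self Q, h] at h1
  have h2 : CFC.sqrt Q x = 0 := by simpa using h1.symm
  rw [← CFC.sqrt_mul_sqrt_self Q, mul_apply_eq, h2, map_zero]

theorem apply_eq_zero_of_le {D G : H →L[ℂ] H} (hD : 0 ≤ D) (h : D ≤ G) {x : H} (hx : G x = 0) :
    D x = 0 := by
  refine apply_eq_zero_of_reApplyInnerSelf_eq_zero hD
    (le_antisymm ?_ (reApplyInnerSelf_nonneg hD x))
  simpa [reApplyInnerSelf_apply, hx] using reApplyInnerSelf_mono h x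

end QuadraticForm

/-! ### Douglas factorization and polar decomposition. -/

section Factorization

variable {H : Type*} [NormedAddCommGroup H] [InnerProductSpace ℂ H] [CompleteSpace H]

/-- **Douglas factorization**: if `‖S x‖ ≤ ‖R x‖` for all `x`, then `S = C R` for a contraction
`C` that vanishes on `ker R*`. -/
theorem exists_contraction_mul_eq {S R : H →L[ℂ] H} (h : ∀ x, ‖S x‖ ≤ ‖R x‖) :
    ∃ C : H →L[ℂ] H, C * R = S ∧ (∀ x, ‖C x‖ ≤ ‖x‖) ∧ ∀ x, star R x = 0 → C x = 0 := by
  let K : Submodule ℂ H := (LinearMap.range (R : H →ₗ[ℂ] H)).topologicalClosure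
  have hK : IsClosed (K : Set H) := Submodule.isClosed_topologicalClosure _
  have : CompleteSpace K := hK.completeSpace_coe
  have hmem : ∀ x, R x ∈ K := fun x => Submodule.le_topologicalClosure _ ⟨x, rfl⟩
  let e : H →ₗ[ℂ] K := (R : H →ₗ[ℂ] H).codRestrict K hmem
  have he : DenseRange e := by
    intro y
    rw [closure_subtype]
    have : (Subtype.val '' Set.range e) = Set.range R := by
      ext z
      constructor
      · rintro ⟨_, ⟨x, rfl⟩, rfl⟩; exact ⟨x, rfl⟩
      · rintro ⟨x, rfl⟩; exact ⟨e x, ⟨x, rfl⟩, rfl⟩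
    rw [this]
    exact y.2
  have hn : ∀ x, ‖(S : H →ₗ[ℂ] H) x‖ ≤ 1 * ‖e x‖ := fun x => by
    rw [one_mul]; exact h x
  let C₀ : K →L[ℂ] H := (S : H →ₗ[ℂ] H).extendOfNorm e
  -- Precomposing with the projection onto the closed range of R makes C vanish on (ran R)ᗮ = ker
  -- R*.
  refine ⟨C₀ ∘L K.orthogonalProjectionOnto, ?_, fun x => ?_, fun x hx => ?_⟩
  · ext x
    have : K.orthogonalProjectionOnto (R x) = e x :=
      Submodule.orthogonalProjectionOnto_mem_subspace_eq_self (e x)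
    change C₀ (K.orthogonalProjectionOnto (R x)) = S x
    rw [this]
    exact LinearMap.extendOfNorm_eq he ⟨1, hn⟩ x
  · calc ‖C₀ (K.orthogonalProjectionOnto x)‖ ≤ 1 * ‖K.orthogonalProjectionOnto x‖ :=
        LinearMap.norm_extendOfNorm_apply_le he 1 hn _
      _ ≤ ‖x‖ := by
        rw [one_mul]; exact Submodule.norm_orthogonalProjectionOnto_apply_le K x
  · have : x ∈ Kᗮ := by
      rw [Submodule.orthogonal_closure]
      rintro _ ⟨y, rfl⟩
      have := adjoint_inner_right R y x
      rw [← star_eq_adjoint, hx, inner_zero_right] at this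
      exact this.symm
    change C₀ (K.orthogonalProjectionOnto x) = 0
    rw [Submodule.orthogonalProjectionOnto_eq_zero_iff.2 this, map_zero]

theorem star_mul_self_le_one_of_contraction {C : H →L[ℂ] H} (h : ∀ x, ‖C x‖ ≤ ‖x‖) :
    star C * C ≤ 1 := by
  refine le_of_reApplyInnerSelf_le (IsSelfAdjoint.star_mul_self C) (.one _) fun x => ?_
  rw [reApplyInnerSelf_star_mul_self, reApplyInnerSelf_one]
  exact pow_le_pow_left₀ (norm_nonneg _) (h x) 2

theorem star_contraction {C : H →L[ℂ] H} (h : ∀ x, ‖C x‖ ≤ ‖x‖) (x : H) : ‖star C x‖ ≤ ‖x‖ := by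
  have h1 : ‖C‖ ≤ 1 := C.opNorm_le_bound zero_le_one (by simpa using h)
  calc ‖star C x‖ ≤ ‖star C‖ * ‖x‖ := le_opNorm _ _
    _ ≤ 1 * ‖x‖ := by gcongr; rwa [norm_star]
    _ = ‖x‖ := one_mul _

/-- **Polar decomposition** of a bounded operator. -/
theorem exists_polar (T : H →L[ℂ] H) :
    ∃ N : H →L[ℂ] H, N * CFC.abs T = T ∧ IsPartialIsometryOp N ∧ (∀ x, T x = 0 → N x = 0) ∧
      star N * N * CFC.abs T = CFC.abs T := by
  have hs : IsSelfAdjoint (CFC.abs T) := (CFC.abs_nonneg T).isSelfAdjoint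
  have hn : ∀ x, ‖T x‖ = ‖CFC.abs T x‖ := norm_eq_of_star_mul_self_eq (by
    rw [hs.star_eq, CFC.abs_mul_abs])
  obtain ⟨N, h1, h2, h3⟩ := exists_contraction_mul_eq (fun x => (hn x).le)
  have h4 : (1 - star N * N) * CFC.abs T = 0 := by
    refine mul_eq_zero_of_star_mul_mul_eq_zero
      (sub_nonneg.2 (star_mul_self_le_one_of_contraction h2)) ?_
    calc star (CFC.abs T) * (1 - star N * N) * CFC.abs T
        = CFC.abs T * CFC.abs T - star (N * CFC.abs T) * (N * CFC.abs T) := by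
          rw [star_mul, hs.star_eq]; noncomm_ring
      _ = 0 := by rw [h1, CFC.abs_mul_abs, sub_self]
  have h5 : CFC.abs T * (1 - star N * N) = 0 := by
    have := congrArg star h4
    simpa [hs.star_eq] using this
  refine ⟨N, h1, ?_, fun x hx => h3 x ?_, ?_⟩
  · ext x
    have := h3 ((1 - star N * N) x) (by
      rw [hs.star_eq, ← mul_apply_eq, h5, zero_apply])
    simp only [sub_apply, map_sub, one_apply_eq_self, sub_eq_zero] at this
    simpa [mul_apply_eq] using this.symm
  · rw [hs.star_eq, ← norm_eq_zero, ← hn, hx, norm_zero]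
  · rw [sub_mul, one_mul, sub_eq_zero] at h4
    exact h4.symm

/-- The range of 1 - N*N lies in ker |T|, which is trivial when T is injective. -/
theorem exists_isometry_polar {T : H →L[ℂ] H} (hT : ∀ x, T x = 0 → x = 0) :
    ∃ N : H →L[ℂ] H, N * CFC.abs T = T ∧ IsIsometryOp N := by
  obtain ⟨N, h1, -, -, h4⟩ := exists_polar T
  have hs : IsSelfAdjoint (CFC.abs T) := (CFC.abs_nonneg T).isSelfAdjoint
  refine ⟨N, h1, ?_⟩
  have h5 : CFC.abs T * (1 - star N * N) = 0 := by
    have := congrArg star (sub_eq_zero.2 h4.symm)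
    simpa [hs.star_eq, mul_sub, mul_assoc] using this
  have h6 : 1 - star N * N = 0 := by
    ext x
    refine hT _ ?_
    rw [← h1, mul_apply_eq, ← mul_apply_eq (CFC.abs T), h5, zero_apply, map_zero]
  exact (sub_eq_zero.1 h6).symm

end Factorization

/-! ### Real powers of positive operators and Hansen's inequality. -/

section RealPowers

variable {H : Type*} [NormedAddCommGroup H] [InnerProductSpace ℂ H] [CompleteSpace H]

/-- Since β lies in the spectrum, evaluation at β is a continuous algebra homomorphism. By
Stone–Weierstrass it is enough to check constants and the identity function. -/
theorem cfc_apply_eigenvector {B : H →L[ℂ] H} (hB : IsSelfAdjoint B) {x : H} {β : ℝ}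
    (hx0 : x ≠ 0) (hx : B x = (β : ℂ) • x) {f : ℝ → ℝ} (hf : ContinuousOn f (spectrum ℝ B)) :
    cfc f B x = (f β : ℂ) • x := by
  have hβ : β ∈ spectrum ℝ B := by
    intro hu
    refine hx0 ?_
    obtain ⟨v, hv⟩ := hu.exists_left_inv
    have h1 : (algebraMap ℝ (H →L[ℂ] H) β - B) x = 0 := by
      rw [sub_apply, hx, Algebra.algebraMap_eq_smul_one, smul_apply, one_apply_eq_self, sub_eq_zero]
      rfl
    rw [← one_apply_eq_self (F := H →L[ℂ] H) x, ← hv, mul_apply_eq, h1, map_zero]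
  rw [cfc_apply f B hB hf]
  suffices h : ∀ g : C(spectrum ℝ B, ℝ), cfcHom hB g x = (g ⟨β, hβ⟩ : ℂ) • x from h _
  intro g
  induction g using ContinuousMap.induction_on_of_compact with
  | const r =>
    have : cfcHom hB (ContinuousMap.const _ r) = algebraMap ℝ (H →L[ℂ] H) r :=
      AlgHomClass.commutes (cfcHom hB) r
    rw [this, Algebra.algebraMap_eq_smul_one]
    rfl
  | id => rw [cfcHom_id hB]; simpa using hx
  | star_id => rw [map_star, cfcHom_id, hB.star_eq]; simpa using hx
  | add f g hf hg => rw [map_add, add_apply, hf, hg, ← add_smul]; simp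
  | mul f g hf hg => rw [map_mul, mul_apply_eq, hg, map_smul, hf, smul_smul]; simp [mul_comm]
  | frequently f hf =>
    have hcl : IsClosed {g : C(spectrum ℝ B, ℝ) | cfcHom hB g x = (g ⟨β, hβ⟩ : ℂ) • x} := by
      refine isClosed_eq ?_ ?_
      · exact (ContinuousLinearMap.apply ℂ H x).continuous.comp (cfcHom_continuous hB)
      · fun_prop
    exact hcl.closure_subset (mem_closure_of_frequently_of_tendsto hf Filter.tendsto_id)

theorem rpow_apply_eigenvector {B : H →L[ℂ] H} (hB : 0 ≤ B) {x : H} {β : ℝ}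
    (hx : B x = (β : ℂ) • x) {r : ℝ} (hr : 0 ≤ r) :
    (B ^ r) x = ((β ^ r : ℝ) : ℂ) • x := by
  by_cases hx0 : x = 0
  · simp [hx0]
  rw [CFC.rpow_eq_cfc_real hB]
  exact cfc_apply_eigenvector hB.isSelfAdjoint hx0 hx (Real.continuous_rpow_const hr).continuousOn

theorem rpow_apply_eq_zero {B : H →L[ℂ] H} (hB : 0 ≤ B) {x : H} (hx : B x = 0) {r : ℝ}
    (hr : 0 < r) : (B ^ r) x = 0 := by
  simpa [Real.zero_rpow hr.ne'] using
    rpow_apply_eigenvector hB (β := 0) (x := x) (by simpa using hx) hr.le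

theorem rpow_mul_rpow {B : H →L[ℂ] H} {r s : ℝ} (hr : 0 ≤ r) (hs : 0 ≤ s) :
    B ^ r * B ^ s = B ^ (r + s) := by
  simp only [CFC.rpow_def]
  rw [← cfc_mul (fun x : NNReal => x ^ r) (fun x => x ^ s) B
    (NNReal.continuous_rpow_const hr).continuousOn (NNReal.continuous_rpow_const hs).continuousOn]
  exact cfc_congr fun x _ => (NNReal.rpow_add_of_nonneg x hr hs).symm

theorem isSelfAdjoint_rpow (B : H →L[ℂ] H) (r : ℝ) : IsSelfAdjoint (B ^ r) :=
  CFC.rpow_nonneg.isSelfAdjoint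

theorem half_mul_half {B : H →L[ℂ] H} (hB : 0 ≤ B) : B ^ (1 / 2 : ℝ) * B ^ (1 / 2 : ℝ) = B := by
  rw [rpow_mul_rpow (by norm_num) (by norm_num)]
  norm_num
  exact CFC.rpow_one B

theorem apply_eq_zero_of_rpow_apply_eq_zero {B : H →L[ℂ] H} (hB : 0 ≤ B) {x : H} {r : ℝ}
    (hr : 0 < r) (hx : (B ^ r) x = 0) : B x = 0 := by
  have h := rpow_apply_eq_zero (B := B ^ r) CFC.rpow_nonneg hx (inv_pos.2 hr)
  rwa [CFC.rpow_rpow_of_exponent_nonneg B r r⁻¹ hr.le (inv_pos.2 hr).le, mul_inv_cancel₀ hr.ne',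
    CFC.rpow_one B] at h

theorem norm_half_apply_sq {B : H →L[ℂ] H} (hB : 0 ≤ B) (x : H) :
    ‖(B ^ (1 / 2 : ℝ)) x‖ ^ 2 = B.reApplyInnerSelf x := by
  rw [← reApplyInnerSelf_star_mul_self, (isSelfAdjoint_rpow B _).star_eq, half_mul_half hB]

theorem cfc_add_rpow {A : H →L[ℂ] H} (hA : 0 ≤ A) {ε : ℝ} (hε : 0 < ε) (s : ℝ) :
    (A + algebraMap ℝ _ ε) ^ s = cfc (fun x : ℝ => (x + ε) ^ s) A := by
  have h : A + algebraMap ℝ _ ε = cfc (fun x : ℝ => x + ε) A := by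
    rw [cfc_add_const ε (fun x => x) A, cfc_id' ℝ A]
  rw [h, CFC.cfc_rpow]
  intro x hx
  have := spectrum_nonneg_of_nonneg hA hx
  positivity

/-- The regularization by ε gives a meaning to the exponent r - 1 ≤ 0 when A is not invertible. The
next lemmas sandwich x^r between x(x+ε)^(r-1) and x(x+ε)^(r-1) + ε^r. -/
theorem half_mul_resolvent_rpow_mul_half {A : H →L[ℂ] H} (hA : 0 ≤ A) {ε : ℝ} (hε : 0 < ε)
    (s : ℝ) :
    A ^ (1 / 2 : ℝ) * (A + algebraMap ℝ _ ε) ^ s * A ^ (1 / 2 : ℝ) =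
      cfc (fun x : ℝ => x * (x + ε) ^ s) A := by
  have hc : ContinuousOn (fun x : ℝ => (x + ε) ^ s) (spectrum ℝ A) := by
    refine ContinuousOn.rpow_const (by fun_prop) fun x hx => Or.inl ?_
    have := spectrum_nonneg_of_nonneg hA hx
    positivity
  have hh : ContinuousOn (fun x : ℝ => x ^ (1 / 2 : ℝ)) (spectrum ℝ A) :=
    (Real.continuous_rpow_const (by norm_num)).continuousOn
  rw [cfc_add_rpow hA hε, CFC.rpow_eq_cfc_real hA, ← cfc_mul _ _ A hh hc,
    ← cfc_mul (fun x : ℝ => x ^ (1 / 2 : ℝ) * (x + ε) ^ s) _ A (hh.mul hc) hh]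
  refine cfc_congr fun x hx => ?_
  have hx0 := spectrum_nonneg_of_nonneg hA hx
  have : x ^ (1 / 2 : ℝ) * x ^ (1 / 2 : ℝ) = x := by
    rw [← Real.sqrt_eq_rpow, Real.mul_self_sqrt hx0]
  calc x ^ (1 / 2 : ℝ) * (x + ε) ^ s * x ^ (1 / 2 : ℝ)
      = (x ^ (1 / 2 : ℝ) * x ^ (1 / 2 : ℝ)) * (x + ε) ^ s := by ring
    _ = _ := by rw [this]

theorem continuousOn_mul_add_rpow {A : H →L[ℂ] H} (hA : 0 ≤ A) {ε : ℝ} (hε : 0 < ε) (s : ℝ) :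
    ContinuousOn (fun x : ℝ => x * (x + ε) ^ s) (spectrum ℝ A) := by
  refine continuousOn_id.mul (ContinuousOn.rpow_const (by fun_prop) fun x hx => Or.inl ?_)
  have := spectrum_nonneg_of_nonneg hA hx
  positivity

theorem half_mul_resolvent_rpow_mul_half_le {A : H →L[ℂ] H} (hA : 0 ≤ A) {ε : ℝ} (hε : 0 < ε)
    {r : ℝ} (hr0 : 0 < r) (hr1 : r ≤ 1) :
    A ^ (1 / 2 : ℝ) * (A + algebraMap ℝ _ ε) ^ (r - 1) * A ^ (1 / 2 : ℝ) ≤ A ^ r := by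
  rw [half_mul_resolvent_rpow_mul_half hA hε, CFC.rpow_eq_cfc_real hA]
  refine cfc_mono (fun x hx => ?_) (continuousOn_mul_add_rpow hA hε _)
    (Real.continuous_rpow_const hr0.le).continuousOn
  have hx0 := spectrum_nonneg_of_nonneg hA hx
  rcases hx0.eq_or_lt with h | h
  · simp [← h, Real.zero_rpow hr0.ne']
  · calc x * (x + ε) ^ (r - 1) ≤ x * x ^ (r - 1) := by
          exact mul_le_mul_of_nonneg_left
            (Real.rpow_le_rpow_of_nonpos h (by linarith) (by linarith)) hx0
      _ = x ^ r := by rw [mul_comm, Real.rpow_sub_one h.ne', div_mul_cancel₀ _ h.ne']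

theorem rpow_le_half_mul_resolvent_rpow_mul_half_add {A : H →L[ℂ] H} (hA : 0 ≤ A) {ε : ℝ}
    (hε : 0 < ε) {r : ℝ} (hr0 : 0 < r) (hr1 : r ≤ 1) :
    A ^ r ≤ A ^ (1 / 2 : ℝ) * (A + algebraMap ℝ _ ε) ^ (r - 1) * A ^ (1 / 2 : ℝ) +
      algebraMap ℝ _ (ε ^ r) := by
  rw [half_mul_resolvent_rpow_mul_half hA hε, CFC.rpow_eq_cfc_real hA,
    ← cfc_add_const _ _ A (continuousOn_mul_add_rpow hA hε _)]
  refine cfc_mono (fun x hx => ?_) (Real.continuous_rpow_const hr0.le).continuousOn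
    ((continuousOn_mul_add_rpow hA hε _).add continuousOn_const)
  have hx0 := spectrum_nonneg_of_nonneg hA hx
  have hp : 0 < x + ε := by positivity
  have h1 : (x + ε) ^ r = x * (x + ε) ^ (r - 1) + ε * (x + ε) ^ (r - 1) := by
    rw [← add_mul, mul_comm, Real.rpow_sub_one hp.ne', div_mul_cancel₀ _ hp.ne']
  have h2 : ε * (x + ε) ^ (r - 1) ≤ ε ^ r := by
    calc ε * (x + ε) ^ (r - 1) ≤ ε * ε ^ (r - 1) := by
          exact mul_le_mul_of_nonneg_left
            (Real.rpow_le_rpow_of_nonpos hε (by linarith) (by linarith)) hε.le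
      _ = ε ^ r := by rw [mul_comm, Real.rpow_sub_one hε.ne', div_mul_cancel₀ _ hε.ne']
  have h3 : x ^ r ≤ (x + ε) ^ r := Real.rpow_le_rpow hx0 (by linarith) hr0.le
  linarith

/-- For r < 1, Löwner–Heinz applies to the exponent 1 - r, and inversion reverses the order. -/
theorem add_rpow_antitone {A D : H →L[ℂ] H} (hD : 0 ≤ D) (hDA : D ≤ A) {ε : ℝ} (hε : 0 < ε)
    {r : ℝ} (hr0 : 0 < r) (hr1 : r ≤ 1) :
    (A + algebraMap ℝ _ ε) ^ (r - 1) ≤ (D + algebraMap ℝ _ ε) ^ (r - 1) := by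
  rcases hr1.eq_or_lt with rfl | hr1
  · have hε' : (0 : H →L[ℂ] H) ≤ algebraMap ℝ _ ε := algebraMap_nonneg _ hε.le
    rw [sub_self, CFC.rpow_zero _ (add_nonneg (hD.trans hDA) hε'),
      CFC.rpow_zero _ (add_nonneg hD hε')]
  have hε' : IsStrictlyPositive (algebraMap ℝ (H →L[ℂ] H) ε) := by
    exact isStrictlyPositive_algebraMap hε
  have hDp : IsStrictlyPositive (D + algebraMap ℝ _ ε) := hε'.nonneg_add hD
  have hAp : IsStrictlyPositive (A + algebraMap ℝ _ ε) := hε'.nonneg_add (hD.trans hDA)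
  have h1 : (D + algebraMap ℝ _ ε) ^ (1 - r) ≤ (A + algebraMap ℝ _ ε) ^ (1 - r) :=
    CFC.rpow_le_rpow ⟨by linarith, by linarith⟩ (by gcongr)
  have h2 := CStarAlgebra.ringInverse_le_ringInverse h1 (hDp.rpow _ _)
  have hr : 1 - r ≠ 0 := by linarith
  rw [show r - 1 = (1 - r) * (-1) by ring, ← CFC.rpow_rpow _ _ _ hr hDp,
    ← CFC.rpow_rpow _ _ _ hr hAp]
  rwa [← CFC.inverse_eq_rpow_neg_one (hDp.rpow _ _), ← CFC.inverse_eq_rpow_neg_one (hAp.rpow _ _)]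

/-- **Hansen's inequality** for `x ↦ x ^ r`, `0 < r ≤ 1`. -/
theorem conj_rpow_le_of_half_eq {A D C : H →L[ℂ] H} (hA : 0 ≤ A) (hD : 0 ≤ D) (hDA : D ≤ A)
    (hC : ∀ x, ‖C x‖ ≤ ‖x‖) (hCA : C * A ^ (1 / 2 : ℝ) = D ^ (1 / 2 : ℝ))
    {r : ℝ} (hr0 : 0 < r) (hr1 : r ≤ 1) : C * A ^ r * star C ≤ D ^ r := by
  have hCA' : A ^ (1 / 2 : ℝ) * star C = D ^ (1 / 2 : ℝ) := by
    simpa [(isSelfAdjoint_rpow _ _).star_eq] using congrArg star hCA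
  refine le_of_reApplyInnerSelf_le ((isSelfAdjoint_rpow A r).conjugate C)
    (isSelfAdjoint_rpow D r) fun x => ?_
  have key : ∀ ε : ℝ, 0 < ε → (C * A ^ r * star C).reApplyInnerSelf x ≤
      (D ^ r).reApplyInnerSelf x + ε ^ r * ‖x‖ ^ 2 := by
    intro ε hε
    have h1 := reApplyInnerSelf_mono (star_right_conjugate_le_conjugate
      (rpow_le_half_mul_resolvent_rpow_mul_half_add hA hε hr0 hr1) C) x
    -- The outer factors A^(1/2) absorb C and become D^(1/2); then antitonicity replaces A + ε by D
    -- + ε in the middle.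
    have h2 : C * (A ^ (1 / 2 : ℝ) * (A + algebraMap ℝ _ ε) ^ (r - 1) * A ^ (1 / 2 : ℝ)) * star C
        ≤ D ^ r := by
      calc C * (A ^ (1 / 2 : ℝ) * (A + algebraMap ℝ _ ε) ^ (r - 1) * A ^ (1 / 2 : ℝ)) * star C
          = D ^ (1 / 2 : ℝ) * (A + algebraMap ℝ _ ε) ^ (r - 1) * star (D ^ (1 / 2 : ℝ)) := by
            rw [(isSelfAdjoint_rpow _ _).star_eq]
            nth_rw 1 [← hCA]
            rw [← hCA']
            simp only [mul_assoc]
        _ ≤ D ^ (1 / 2 : ℝ) * (D + algebraMap ℝ _ ε) ^ (r - 1) * star (D ^ (1 / 2 : ℝ)) :=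
            star_right_conjugate_le_conjugate (add_rpow_antitone hD hDA hε hr0 hr1) _
        _ ≤ D ^ r := by
            rw [(isSelfAdjoint_rpow _ _).star_eq]
            exact half_mul_resolvent_rpow_mul_half_le hD hε hr0 hr1
    have h3 := reApplyInnerSelf_mono h2 x
    rw [mul_add, add_mul, reApplyInnerSelf_add, reApplyInnerSelf_conj C (algebraMap ℝ _ _),
      Algebra.algebraMap_eq_smul_one (ε ^ r), reApplyInnerSelf_real_smul, reApplyInnerSelf_one] at h1
    have h4 : ‖star C x‖ ^ 2 ≤ ‖x‖ ^ 2 :=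
      pow_le_pow_left₀ (norm_nonneg _) (star_contraction hC x) 2
    have h5 : ε ^ r * ‖star C x‖ ^ 2 ≤ ε ^ r * ‖x‖ ^ 2 := by gcongr
    linarith
  have hlim : Filter.Tendsto (fun ε : ℝ => (D ^ r).reApplyInnerSelf x + ε ^ r * ‖x‖ ^ 2)
      (nhdsWithin 0 (Set.Ioi 0)) (nhds ((D ^ r).reApplyInnerSelf x + 0 ^ r * ‖x‖ ^ 2)) := by
    refine Filter.Tendsto.mono_left ?_ nhdsWithin_le_nhds
    exact (((Real.continuous_rpow_const hr0.le).mul continuous_const).const_add _).tendsto 0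
  rw [Real.zero_rpow hr0.ne', zero_mul, add_zero] at hlim
  exact ge_of_tendsto hlim (Filter.eventually_of_mem self_mem_nhdsWithin key)

end RealPowers

/-! ### Exponents r ≤ 1: subadditivity up to isometries, and Jensen's inequality. -/

section Subadditivity

variable {H : Type*} [NormedAddCommGroup H] [InnerProductSpace ℂ H] [CompleteSpace H]

theorem rpow_mul_eq_zero {S E : H →L[ℂ] H} (hS : 0 ≤ S) {a b : ℝ} (ha : 0 < a) (hb : 0 < b)
    (h : S ^ a * E = 0) : S ^ b * E = 0 := by
  ext x
  refine rpow_apply_eq_zero hS (apply_eq_zero_of_rpow_apply_eq_zero hS ha ?_) hb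
  exact congr($h x)

/-- The square roots of positive summands `A i` of `S = ∑ A i` factor through the square root of
`S` by contractions `C i` whose squares sum to the identity on the support of `S`. -/
theorem exists_contractions_of_sum {ι : Type*} [Fintype ι] {A : ι → H →L[ℂ] H} {S : H →L[ℂ] H}
    (hA : ∀ i, 0 ≤ A i) (hS : ∑ i, A i = S) :
    ∃ C : ι → H →L[ℂ] H, (∀ i x, ‖C i x‖ ≤ ‖x‖) ∧
      (∀ i, C i * S ^ (1 / 2 : ℝ) = A i ^ (1 / 2 : ℝ)) ∧ (∀ i x, S x = 0 → C i x = 0) ∧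
      ∀ r : ℝ, 0 < r → ∑ i, S ^ (r / 2) * star (C i) * (C i * S ^ (r / 2)) = S ^ r := by
  have hS0 : 0 ≤ S := hS ▸ Finset.sum_nonneg fun i _ => hA i
  have hle : ∀ i, A i ≤ S := fun i => by
    rw [← hS]; exact Finset.single_le_sum (fun j _ => hA j) (Finset.mem_univ i)
  have hn : ∀ i x, ‖(A i ^ (1 / 2 : ℝ)) x‖ ≤ ‖(S ^ (1 / 2 : ℝ)) x‖ := fun i x => by
    rw [← sq_le_sq₀ (norm_nonneg _) (norm_nonneg _), norm_half_apply_sq (hA i),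
      norm_half_apply_sq hS0]
    exact reApplyInnerSelf_mono (hle i) x
  choose C h1 h2 h3 using fun i => exists_contraction_mul_eq (hn i)
  refine ⟨C, h2, h1, fun i x hx => h3 i x ?_, fun r hr => ?_⟩
  · rw [(isSelfAdjoint_rpow S _).star_eq]
    exact rpow_apply_eq_zero hS0 hx (by norm_num)
  -- E need not vanish off the support of S. Since all positive powers of S have the same kernel,
  -- S^(1/2) E S^(1/2) = 0 passes to S^(r/2) E S^(r/2) = 0, one side at a time.
  · set E : H →L[ℂ] H := ∑ i, star (C i) * C i - 1 with hE
    have hEs : star E = E := by simp [hE]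
    have hconj : ∀ a : ℝ, 0 < a → S ^ (a / 2) * E * S ^ (a / 2) =
        ∑ i, S ^ (a / 2) * star (C i) * (C i * S ^ (a / 2)) - S ^ a := by
      intro a ha
      have : S ^ (a / 2) * S ^ (a / 2) = S ^ a := by
        rw [rpow_mul_rpow (by positivity) (by positivity)]; ring_nf
      rw [hE, mul_sub, sub_mul, mul_one, this, Finset.mul_sum, Finset.sum_mul]
      simp only [mul_assoc]
    have e1 : S ^ (1 / 2 : ℝ) * E * S ^ (1 / 2 : ℝ) = 0 := by
      rw [hconj 1 one_pos, sub_eq_zero, CFC.rpow_one S]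
      refine (Finset.sum_congr rfl fun i _ => ?_).trans hS
      have := congrArg star (h1 i)
      rw [star_mul, (isSelfAdjoint_rpow S _).star_eq, (isSelfAdjoint_rpow (A i) _).star_eq] at this
      rw [this, h1, half_mul_half (hA i)]
    have e2 : S ^ (r / 2) * (E * S ^ (1 / 2 : ℝ)) = 0 :=
      rpow_mul_eq_zero hS0 (a := 1 / 2) (by norm_num) (by positivity) (by rw [← mul_assoc, e1])
    have e3 : S ^ (1 / 2 : ℝ) * (E * S ^ (r / 2)) = 0 := by
      have := congrArg star e2
      simpa [(isSelfAdjoint_rpow S _).star_eq, hEs, mul_assoc] using this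
    have e4 : S ^ (r / 2) * (E * S ^ (r / 2)) = 0 :=
      rpow_mul_eq_zero hS0 (by norm_num) (by positivity) e3
    rw [← mul_assoc, hconj r hr, sub_eq_zero] at e4
    exact e4

/-- If `T + J P` is injective, where `P` is the projection onto `ker T` and `J` maps `ker T` into
`ker T*`, then `T T*` is conjugate to `T* T` by an isometry. -/
theorem exists_isometry_conj_star_mul_self {T J P : H →L[ℂ] H} (hP : IsSelfAdjoint P)
    (hPP : P * P = P) (hTP : T * P = 0) (hJ : star T * J * P = 0)
    (hinj : ∀ x, (T + J * P) x = 0 → x = 0) :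
    ∃ U : H →L[ℂ] H, IsIsometryOp U ∧ T * star T = U * (star T * T) * star U := by
  obtain ⟨N, hN, hNi⟩ := exists_isometry_polar hinj
  set Z := T + J * P with hZ
  have hZP : Z * (1 - P) = T := by
    rw [hZ, mul_sub, mul_one, add_mul, hTP, mul_assoc, hPP]; abel
  have hJ' : P * star J * T = 0 := by
    have := congrArg star hJ
    simpa [hP.star_eq, mul_assoc] using this
  have hZT : star Z * T = star T * T := by
    rw [hZ, star_add, star_mul, hP.star_eq, add_mul, hJ', add_zero]
  have hTZ : star T * Z = star T * T := by
    rw [hZ, mul_add, ← mul_assoc, hJ, add_zero]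
  -- T and J P have orthogonal ranges, so Z*Z is block diagonal for P. Therefore |Z| commutes with
  -- P, and T = N |Z| (1 - P) with N an isometry.
  have hcomm : Commute (star Z * Z) P := by
    have h1 : star Z * Z * (1 - P) = star T * T := by rw [mul_assoc, hZP, hZT]
    have h2 : (1 - P) * (star Z * Z) = star T * T := by
      have := congrArg star hZP
      rw [star_mul, star_sub, star_one, hP.star_eq] at this
      rw [← mul_assoc, this, hTZ]
    have h3 := h1.trans h2.symm
    rw [mul_sub, sub_mul, mul_one, one_mul] at h3
    exact sub_right_injective h3
  have habs : Commute (CFC.abs Z) P := hcomm.cfcₙ_nnreal _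
  have hs : IsSelfAdjoint (CFC.abs Z) := (CFC.abs_nonneg Z).isSelfAdjoint
  have hTT : star T * T = CFC.abs Z * (1 - P) * (1 - P) * CFC.abs Z := by
    have h1 : star T * T = CFC.abs Z * CFC.abs Z * (1 - P) := by
      rw [CFC.abs_mul_abs, mul_assoc, hZP, hZT]
    have h2 : (1 - P) * (1 - P) = 1 - P := by
      rw [mul_sub, sub_mul, sub_mul, hPP]; simp
    have h3 : CFC.abs Z * (1 - P) = (1 - P) * CFC.abs Z := by
      rw [mul_sub, sub_mul, habs.eq, mul_one, one_mul]
    rw [h1, mul_assoc _ (1 - P) (1 - P), h2, mul_assoc, h3, ← mul_assoc, h3]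
  refine ⟨N, hNi, ?_⟩
  have h4 : N * CFC.abs Z * (1 - P) = T := by rw [hN, hZP]
  have h5 : star T = (1 - P) * CFC.abs Z * star N := by
    rw [← h4]; simp [hs.star_eq, hP.star_eq, mul_assoc]
  calc T * star T = (N * CFC.abs Z * (1 - P)) * ((1 - P) * CFC.abs Z * star N) := by rw [h4, ← h5]
    _ = N * (star T * T) * star N := by rw [hTT]; simp only [mul_assoc]

theorem exists_ker_projection (T : H →L[ℂ] H) :
    ∃ P : H →L[ℂ] H, IsSelfAdjoint P ∧ P * P = P ∧ T * P = 0 ∧ ∀ x, T x = 0 → P x = x := by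
  let K := LinearMap.ker (T : H →ₗ[ℂ] H)
  have : CompleteSpace K := T.isClosed_ker.completeSpace_coe
  refine ⟨K.starProjection, isSelfAdjoint_starProjection K, K.isIdempotentElem_starProjection.eq,
    ?_, fun x hx => Submodule.starProjection_eq_self_iff.2 hx⟩
  ext x
  exact Submodule.starProjection_apply_mem K x

/-- With T = S^(r/2) C*, an isometry moves T T* to T* T = C S^r C*, and Hansen's inequality bounds
the latter by D^r. -/
theorem exists_isometry_conj_rpow_ge {S D C : H →L[ℂ] H} (hS : 0 ≤ S) (hD : 0 ≤ D) (hDS : D ≤ S)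
    (hC : ∀ x, ‖C x‖ ≤ ‖x‖) (hCS : C * S ^ (1 / 2 : ℝ) = D ^ (1 / 2 : ℝ))
    (hC0 : ∀ x, S x = 0 → C x = 0) {r : ℝ} (hr0 : 0 < r) (hr1 : r ≤ 1) :
    ∃ U : H →L[ℂ] H, IsIsometryOp U ∧
      S ^ (r / 2) * star C * (C * S ^ (r / 2)) ≤ U * D ^ r * star U := by
  have hsS : ∀ a : ℝ, star (S ^ a) = S ^ a := fun a => (isSelfAdjoint_rpow S a).star_eq
  have hSC : S ^ (1 / 2 : ℝ) * star C = D ^ (1 / 2 : ℝ) := by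
    simpa [(isSelfAdjoint_rpow _ _).star_eq] using congrArg star hCS
  obtain ⟨T, hT⟩ : ∃ T, T = S ^ (r / 2) * star C := ⟨_, rfl⟩
  have hTs : star T = C * S ^ (r / 2) := by rw [hT, star_mul, star_star, hsS]
  obtain ⟨P, hPs, hPP, hTP, hPker⟩ := exists_ker_projection T
  obtain ⟨P₀, hPs₀, hPP₀, hSP₀, hPker₀⟩ := exists_ker_projection S
  -- The power is chosen so that T* J = C S^(1/2) = D^(1/2), which kills ker T because D^(1/2) =
  -- S^(1/2) C*. Adding P₀ makes J injective even where S vanishes.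
  obtain ⟨J, hJdef⟩ : ∃ J, J = S ^ ((1 - r) / 2) + P₀ := ⟨_, rfl⟩
  have hK : ∀ x, T (P x) = 0 := fun x => congr($hTP x)
  have hK₀ : ∀ x, S (P₀ x) = 0 := fun x => congr($hSP₀ x)
  have hJT : ∀ y, T y = 0 → star T (J y) = 0 := by
    intro y hy
    have h1 : S (star C y) = 0 := apply_eq_zero_of_rpow_apply_eq_zero hS (r := r / 2)
      (by positivity) (by rw [← mul_apply_eq, ← hT, hy])
    have h2 : star C y = 0 := by
      have h3 := hC0 _ h1
      have h4 := adjoint_inner_right C (star C y) y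
      rw [h3, inner_zero_left] at h4
      exact inner_self_eq_zero.1 h4
    have h5 : (D ^ (1 / 2 : ℝ)) y = 0 := by rw [← hSC, mul_apply_eq, h2, map_zero]
    have h6 : S ^ (r / 2) * S ^ ((1 - r) / 2) = S ^ (1 / 2 : ℝ) := by
      rw [rpow_mul_rpow (by positivity) (by linarith)]; ring_nf
    have h7 : (S ^ (r / 2)) (P₀ y) = 0 := rpow_apply_eq_zero hS (hK₀ y) (by positivity)
    have h8 : (S ^ (r / 2)) (J y) = (S ^ (1 / 2 : ℝ)) y := by
      rw [← h6, hJdef, mul_apply_eq, add_apply, map_add, h7, add_zero]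
    rw [hTs, mul_apply_eq, h8, ← mul_apply_eq, hCS, h5]
  have hJ : star T * J * P = 0 := by
    ext x; exact hJT _ (hK x)
  have hinj : ∀ x, (T + J * P) x = 0 → x = 0 := by
    intro x hx
    have h1 : star T (T x) = 0 := by
      have h2 := congrArg (fun z => star T z) hx
      change star T ((T + J * P) x) = star T 0 at h2
      rw [add_apply, map_add, map_zero, ← mul_apply_eq (star T) (J * P), ← mul_assoc, hJ,
        zero_apply, add_zero] at h2
      exact h2
    have h3 : T x = 0 := by
      have h4 := adjoint_inner_right T x (T x)
      rw [← star_eq_adjoint, h1, inner_zero_right] at h4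
      exact inner_self_eq_zero.1 h4.symm
    have h5 : P x = x := hPker _ h3
    have h6 : J x = 0 := by
      rw [add_apply, h3, zero_add, mul_apply_eq, h5] at hx
      exact hx
    have h7 : (S ^ ((1 - r) / 2)).reApplyInnerSelf x + P₀.reApplyInnerSelf x = 0 := by
      rw [← reApplyInnerSelf_add, ← hJdef, reApplyInnerSelf_apply, h6, inner_zero_left, map_zero]
    have hq : 0 ≤ S ^ ((1 - r) / 2) := CFC.rpow_nonneg
    have h8 := reApplyInnerSelf_nonneg hq x
    have h9 : 0 ≤ P₀.reApplyInnerSelf x := reApplyInnerSelf_nonneg (by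
      rw [← hPP₀]
      nth_rw 1 [← hPs₀.star_eq]
      exact star_mul_self_nonneg P₀) x
    have h10 : (S ^ ((1 - r) / 2)) x = 0 :=
      apply_eq_zero_of_reApplyInnerSelf_eq_zero hq
        ((add_eq_zero_iff_of_nonneg h8 h9).1 h7).1
    have h11 : P₀ x = 0 := by simpa [hJdef, h10] using h6
    have h12 : S x = 0 := by
      refine apply_eq_zero_of_rpow_apply_eq_zero hS (r := 1 / 2) (by norm_num) ?_
      have : S ^ (r / 2) * S ^ ((1 - r) / 2) = S ^ (1 / 2 : ℝ) := by
        rw [rpow_mul_rpow (by positivity) (by linarith)]; ring_nf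
      rw [← this, mul_apply_eq, h10, map_zero]
    have h13 : P₀ x = x := hPker₀ _ h12
    rw [← h13, h11]
  obtain ⟨U, hU, hTU⟩ := exists_isometry_conj_star_mul_self hPs hPP hTP hJ hinj
  refine ⟨U, hU, ?_⟩
  rw [← hT, ← hTs, hTU]
  refine star_right_conjugate_le_conjugate ?_ U
  have : star T * T = C * S ^ r * star C := by
    have h : S ^ (r / 2) * S ^ (r / 2) = S ^ r := by
      rw [rpow_mul_rpow (by positivity) (by positivity)]; ring_nf
    rw [hTs, hT, ← h]; simp only [mul_assoc]
  rw [this]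
  exact conj_rpow_le_of_half_eq hS hD hDS hC hCS hr0 hr1

/-- Subadditivity of `x ↦ x ^ r`, `0 < r ≤ 1`, up to isometric conjugations. -/
theorem exists_isometries_sum_rpow_le {ι : Type*} [Fintype ι] {A : ι → H →L[ℂ] H}
    (hA : ∀ i, 0 ≤ A i) {r : ℝ} (hr0 : 0 < r) (hr1 : r ≤ 1) :
    ∃ U : ι → H →L[ℂ] H, (∀ i, IsIsometryOp (U i)) ∧
      (∑ i, A i) ^ r ≤ ∑ i, U i * A i ^ r * star (U i) := by
  obtain ⟨C, h1, h2, h3, h4⟩ := exists_contractions_of_sum hA rfl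
  have hS : 0 ≤ ∑ i, A i := Finset.sum_nonneg fun i _ => hA i
  choose U hU hle using fun i => exists_isometry_conj_rpow_ge hS (hA i)
    (Finset.single_le_sum (fun j _ => hA j) (Finset.mem_univ i)) (h1 i) (h2 i) (h3 i) hr0 hr1
  refine ⟨U, hU, ?_⟩
  rw [← h4 r hr0]
  exact Finset.sum_le_sum fun i _ => hle i

/-- Jensen's inequality for the operator concave function `x ↦ x ^ r`, `0 < r ≤ 1`. -/
theorem card_rpow_smul_sum_rpow_le {t : ℕ} {B : Fin t → H →L[ℂ] H} (hB : ∀ j, 0 ≤ B j)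
    {r : ℝ} (hr0 : 0 < r) (hr1 : r ≤ 1) :
    ((t : ℝ) ^ (r - 1)) • ∑ j, B j ^ r ≤ (∑ j, B j) ^ r := by
  rcases Nat.eq_zero_or_pos t with rfl | ht
  · simp
  have ht' : (0 : ℝ) < t := by exact_mod_cast ht
  -- Equal weights 1/t at the points t B_j produce the constant t^r / t = t^(r-1).
  have h1 := (CFC.concaveOn_rpow (A := H →L[ℂ] H) (p := r) ⟨hr0.le, hr1⟩).le_map_sum
    (t := Finset.univ) (w := fun _ : Fin t => (t : ℝ)⁻¹) (p := fun j => (t : ℝ) • B j)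
    (fun _ _ => by positivity) (by simp [ht'.ne']) (fun j _ => smul_nonneg ht'.le (hB j))
  have h2 : ∀ j, ((t : ℝ) • B j) ^ r = ((t : ℝ) ^ r) • B j ^ r := by
    intro j
    rw [CFC.rpow_eq_cfc_real (smul_nonneg ht'.le (hB j)), CFC.rpow_eq_cfc_real (hB j),
      ← cfc_smul _ _ _ (Real.continuous_rpow_const hr0.le).continuousOn,
      ← cfc_comp_smul _ _ _ (Real.continuous_rpow_const hr0.le).continuousOn]
    refine cfc_congr fun x hx => ?_
    have hx0 := spectrum_nonneg_of_nonneg (hB j) hx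
    simp [Real.mul_rpow ht'.le hx0]
  simp only [h2, smul_smul, inv_mul_cancel₀ ht'.ne', one_smul] at h1
  rw [Finset.smul_sum]
  convert h1 using 3
  rw [Real.rpow_sub_one ht'.ne', div_eq_inv_mul]

end Subadditivity

/-! ### Diagonalization of compact operators and spectral estimates. -/

section CompactSpectral

universe u

variable {H : Type*} [NormedAddCommGroup H] [InnerProductSpace ℂ H]

/-- The eigenvalues `≥ c > 0` of a compact operator on an orthonormal family are finitely many. -/
theorem finite_setOf_le_eigenvalue {B : H →L[ℂ] H} (hc : IsCompactOperator B) {ι : Type*}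
    {b : ι → H} (hb : Orthonormal ℂ b) {β : ι → ℝ} (hβ : ∀ i, B (b i) = (β i : ℂ) • b i)
    {c : ℝ} (hc0 : 0 < c) : {i | c ≤ β i}.Finite := by
  by_contra hinf
  have hinf : {i | c ≤ β i}.Infinite := hinf
  let f := hinf.natEmbedding
  obtain ⟨K, hK, hKB⟩ := hc.image_closedBall_subset_compact (f := (B : H →ₗ[ℂ] H)) 1
  have hmem : ∀ n, B (b (f n)) ∈ K := fun n => hKB ⟨b (f n), by simp [hb.1], rfl⟩
  obtain ⟨a, -, φ, hφ, hlim⟩ := hK.tendsto_subseq hmem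
  obtain ⟨N, hN⟩ := Metric.cauchySeq_iff.1 hlim.cauchySeq c hc0
  have h1 := hN N le_rfl (N + 1) (Nat.le_succ N)
  have hne : (f (φ (N + 1)) : ι) ≠ f (φ N) := fun h =>
    (hφ (Nat.lt_succ_self N)).ne' (f.injective (Subtype.ext h))
  -- Pairing with the unit vector b shows that images of distinct eigenvectors stay at distance at
  -- least c, so no subsequence is Cauchy.
  have h2 : inner ℂ (b (f (φ N))) (B (b (f (φ N))) - B (b (f (φ (N + 1))))) =
      (β (f (φ N)) : ℂ) := by
    rw [inner_sub_right, hβ, hβ, inner_smul_right, inner_smul_right, hb.2 hne.symm,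
      inner_self_eq_norm_sq_to_K, hb.1]
    simp
  have h3 := norm_inner_le_norm (𝕜 := ℂ) (b (f (φ N))) (B (b (f (φ N))) - B (b (f (φ (N + 1)))))
  rw [h2, hb.1, one_mul, Complex.norm_real] at h3
  have h4 : c ≤ β (f (φ N)) := (f (φ N)).2
  rw [dist_eq_norm] at h1
  exact absurd ((h4.trans (le_abs_self _)).trans h3) (not_le.2 h1)

variable [CompleteSpace H]

/-- Hilbert bases of the mutually orthogonal eigenspaces are glued together; the spectral theorem
says that the eigenspaces span a dense subspace. -/
theorem exists_complex_eigenbasis {H : Type u} [NormedAddCommGroup H]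
    [InnerProductSpace ℂ H] [CompleteSpace H] {B : H →L[ℂ] H} (hB : IsSelfAdjoint B)
    (hc : IsCompactOperator B) :
    ∃ (ι : Type u) (b : HilbertBasis ι ℂ H) (μ : ι → ℂ), ∀ i, B (b i) = μ i • b i := by
  have hsym : (B : H →ₗ[ℂ] H).IsSymmetric := hB.isSymmetric
  let E : ℂ → Submodule ℂ H := Module.End.eigenspace (B : H →ₗ[ℂ] H)
  have hE : ∀ μ x, x ∈ E μ ↔ B x = μ • x := fun μ x => Module.End.mem_eigenspace_iff
  have hcl : ∀ μ, CompleteSpace (E μ) := fun μ => by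
    have : IsClosed (E μ : Set H) := by
      have : (E μ : Set H) = {x | B x = μ • x} := Set.ext fun x => hE μ x
      rw [this]
      exact isClosed_eq B.continuous (continuous_const_smul μ)
    exact this.completeSpace_coe
  choose w b hb using fun μ => exists_hilbertBasis ℂ (E μ)
  have hv : Orthonormal ℂ (fun a : Σ μ, w μ => ((b a.1 a.2 : E a.1) : H)) :=
    hsym.orthogonalFamily_eigenspaces.orthonormal_sigma_orthonormal fun μ => (b μ).orthonormal
  have hspan : (Submodule.span ℂ (Set.range fun a : Σ μ, w μ => ((b a.1 a.2 : E a.1) : H)))ᗮ =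
      ⊥ := by
    rw [eq_bot_iff]
    intro x hx
    have hbot := ContinuousLinearMap.orthogonalComplement_iSup_eigenspaces_eq_bot hc hsym
    rw [← hbot, ← Submodule.iInf_orthogonal, Submodule.mem_iInf]
    intro μ
    have : CompleteSpace (E μ) := hcl μ
    refine Submodule.orthogonalProjectionOnto_eq_zero_iff.1 ?_
    refine (b μ).repr.injective ?_
    rw [map_zero]
    ext i
    rw [HilbertBasis.repr_apply_apply, Submodule.inner_orthogonalProjectionOnto_eq_of_mem_left]
    exact hx _ (Submodule.subset_span ⟨⟨μ, i⟩, rfl⟩)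
  refine ⟨Σ μ, w μ, HilbertBasis.mkOfOrthogonalEqBot hv hspan, fun a => a.1, fun a => ?_⟩
  rw [HilbertBasis.coe_mkOfOrthogonalEqBot]
  exact (hE a.1 _).1 (b a.1 a.2).2

/-- A positive compact operator has a Hilbert basis of eigenvectors. -/
theorem exists_eigenbasis {H : Type u} [NormedAddCommGroup H] [InnerProductSpace ℂ H]
    [CompleteSpace H] {B : H →L[ℂ] H} (hB : 0 ≤ B) (hc : IsCompactOperator B) :
    ∃ (ι : Type u) (b : HilbertBasis ι ℂ H) (β : ι → ℝ), (∀ i, 0 ≤ β i) ∧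
      (∀ i, B (b i) = (β i : ℂ) • b i) ∧ ∀ c : ℝ, 0 < c → {i | c ≤ β i}.Finite := by
  obtain ⟨ι, b, μ, hμ⟩ := exists_complex_eigenbasis hB.isSelfAdjoint hc
  have hv := b.orthonormal
  have hre : ∀ i, (((μ i).re : ℝ) : ℂ) = μ i := fun i => by
    have h := hB.isSelfAdjoint.isSymmetric (b i) (b i)
    simp only [coe_coe] at h
    rw [hμ, inner_smul_left, inner_smul_right, inner_self_eq_norm_sq_to_K, hv.1] at h
    exact Complex.conj_eq_iff_re.1 (by simpa using h)
  have hβ : ∀ i, B (b i) = (((μ i).re : ℝ) : ℂ) • b i := fun i => by rw [hre, hμ]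
  refine ⟨ι, b, fun i => (μ i).re, fun i => ?_, hβ,
    fun c hc0 => finite_setOf_le_eigenvalue hc hv hβ hc0⟩
  have h := reApplyInnerSelf_nonneg hB (b i)
  rw [reApplyInnerSelf_apply, hβ, inner_smul_left, inner_self_eq_norm_sq_to_K, hv.1] at h
  simpa using h

theorem hasSum_reApplyInnerSelf {B : H →L[ℂ] H} (hB : IsSelfAdjoint B) {ι : Type*}
    (b : HilbertBasis ι ℂ H) {β : ι → ℝ} (hβ : ∀ i, B (b i) = (β i : ℂ) • b i) (x : H) :
    HasSum (fun i => β i * ‖inner ℂ (b i) x‖ ^ 2) (B.reApplyInnerSelf x) := by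
  have h := Complex.hasSum_re (b.hasSum_inner_mul_inner (B x) x)
  rw [reApplyInnerSelf_apply]
  convert h using 2 with i
  swap
  · rfl
  have h1 : inner ℂ (B x) (b i) = β i * inner ℂ x (b i) := by
    have := hB.isSymmetric x (b i)
    simp only [coe_coe] at this
    rw [this, hβ, inner_smul_right]
  rw [h1, mul_assoc, ← inner_conj_symm x (b i), ← Complex.normSq_eq_conj_mul_self,
    Complex.normSq_eq_norm_sq, ← Complex.ofReal_mul, Complex.ofReal_re]

theorem hasSum_norm_inner_sq {ι : Type*} (b : HilbertBasis ι ℂ H) (x : H) :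
    HasSum (fun i => ‖inner ℂ (b i) x‖ ^ 2) (‖x‖ ^ 2) := by
  have h := hasSum_reApplyInnerSelf (B := 1) (.one _) b (β := fun _ => 1) (by simp) x
  rw [reApplyInnerSelf_one] at h
  simpa using h

/-- A partial isometry carrying one orthonormal family to another one. -/
theorem exists_partialIsometry_of_orthonormal {J : Type*} {f e : J → H} (hf : Orthonormal ℂ f)
    (he : Orthonormal ℂ e) :
    ∃ V : H →L[ℂ] H, IsPartialIsometryOp V ∧ (∀ j, V (f j) = e j) ∧
      ∀ x, V x = 0 ↔ ∀ j, inner ℂ (f j) x = 0 := by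
  classical
  -- Each orthonormal family gives an isometric embedding of ℓ²(J); the partial isometry is Φ_e
  -- Φ_f*.
  let Φ : ∀ {g : J → H}, Orthonormal ℂ g → lp (fun _ : J => ℂ) 2 →L[ℂ] H := fun hg =>
    hg.orthogonalFamily.linearIsometry.toContinuousLinearMap
  have hΦ : ∀ {g : J → H} (hg : Orthonormal ℂ g), adjoint (Φ hg) ∘L Φ hg = 1 := fun hg =>
    (norm_map_iff_adjoint_comp_self (Φ hg)).1 hg.orthogonalFamily.linearIsometry.norm_map
  have hΦs : ∀ {g : J → H} (hg : Orthonormal ℂ g) j, Φ hg (lp.single 2 j 1) = g j := fun hg j => by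
    have := hg.orthogonalFamily.linearIsometry_apply_single (i := j) (1 : ℂ)
    exact this.trans (by simp)
  have hΦ0 : ∀ x, adjoint (Φ hf) x = 0 ↔ ∀ j, inner ℂ (f j) x = 0 := by
    intro x
    constructor
    · intro h j
      rw [← hΦs hf j, ← adjoint_inner_right, h, inner_zero_right]
    · intro h
      refine ext_inner_left ℂ fun z => ?_
      rw [adjoint_inner_right, inner_zero_right]
      have h1 := hf.orthogonalFamily.hasSum_linearIsometry z
      have h2 := h1.mapL (innerSLFlip ℂ x)
      have h3 : ∀ j, innerSLFlip ℂ x (((LinearIsometry.toSpanSingleton ℂ H (hf.1 j)) : ℂ → H) (z j))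
          = 0 := fun j => by
        simp [h j]
      simp only [h3] at h2
      exact h2.unique hasSum_zero
  have hval : ∀ y, (adjoint (Φ hf)) (Φ hf y) = y := fun y => congr($(hΦ hf) y)
  have hval' : ∀ y, (adjoint (Φ he)) (Φ he y) = y := fun y => congr($(hΦ he) y)
  refine ⟨Φ he ∘L adjoint (Φ hf), ?_, fun j => ?_, fun x => ?_⟩
  · ext x
    rw [star_eq_adjoint, adjoint_comp, adjoint_adjoint]
    change Φ he (adjoint (Φ hf) (Φ hf (adjoint (Φ he) (Φ he (adjoint (Φ hf) x))))) = _
    rw [hval, hval']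
    rfl
  · change Φ he (adjoint (Φ hf) (f j)) = e j
    rw [← hΦs hf j, hval, hΦs he]
  · rw [← hΦ0]
    change Φ he (adjoint (Φ hf) x) = 0 ↔ _
    constructor
    · intro h
      rw [← hval' (adjoint (Φ hf) x), h, map_zero]
    · intro h
      rw [h, map_zero]

/-- By Bernoulli, x^r lies above its tangent line at c = ⟨By, y⟩. The constant term c^r (1 - r) is
nonpositive, so ‖y‖ ≤ 1 suffices in place of ‖y‖ = 1. -/
theorem rpow_reApplyInnerSelf_le {B : H →L[ℂ] H} (hB : 0 ≤ B) {r : ℝ} (hr : 1 ≤ r) {y : H}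
    (hy : ‖y‖ ≤ 1) : B.reApplyInnerSelf y ^ r ≤ (B ^ r).reApplyInnerSelf y := by
  obtain ⟨c, hcdef⟩ : ∃ c, c = B.reApplyInnerSelf y := ⟨_, rfl⟩
  rw [← hcdef]
  have hr0 : 0 < r := by linarith
  have hc0 := reApplyInnerSelf_nonneg hB y
  rcases hc0.eq_or_lt with h | hc
  · rw [hcdef, ← h, Real.zero_rpow hr0.ne']
    have hBr : 0 ≤ B ^ r := CFC.rpow_nonneg
    exact reApplyInnerSelf_nonneg hBr y
  rw [← hcdef] at hc
  have hle : (r * c ^ (r - 1)) • B + algebraMap ℝ _ (c ^ r * (1 - r)) ≤ B ^ r := by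
    have h1 : (r * c ^ (r - 1)) • B + algebraMap ℝ _ (c ^ r * (1 - r)) =
        cfc (fun x : ℝ => (r * c ^ (r - 1)) • x + c ^ r * (1 - r)) B := by
      rw [cfc_add_const _ (fun x : ℝ => (r * c ^ (r - 1)) • x) B, cfc_smul _ (fun x => x) B,
        cfc_id' ℝ B]
    rw [h1, CFC.rpow_eq_cfc_real hB]
    refine cfc_mono (fun x hx => ?_) (by fun_prop)
      (Real.continuous_rpow_const hr0.le).continuousOn
    have hx0 := spectrum_nonneg_of_nonneg hB hx
    have h2 := one_add_mul_self_le_rpow_one_add (s := x / c - 1)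
      (by have : 0 ≤ x / c := by positivity
          linarith) hr
    rw [add_sub_cancel, Real.div_rpow hx0 hc.le, le_div_iff₀ (by positivity)] at h2
    rw [Real.rpow_sub_one hc.ne', smul_eq_mul]
    calc r * (c ^ r / c) * x + c ^ r * (1 - r) = (1 + r * (x / c - 1)) * c ^ r := by
          field_simp; ring
      _ ≤ x ^ r := h2
  have h := reApplyInnerSelf_mono hle y
  rw [reApplyInnerSelf_add, reApplyInnerSelf_real_smul, Algebra.algebraMap_eq_smul_one,
    reApplyInnerSelf_real_smul, reApplyInnerSelf_one, ← hcdef] at h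
  have h3 : c ^ (r - 1) * c = c ^ r := by
    rw [Real.rpow_sub_one hc.ne', div_mul_cancel₀ _ hc.ne']
  have h4 : ‖y‖ ^ 2 ≤ 1 := pow_le_one₀ (norm_nonneg _) hy
  have h5 : 0 ≤ c ^ r * (r - 1) * (1 - ‖y‖ ^ 2) :=
    mul_nonneg (mul_nonneg (by positivity) (by linarith)) (by linarith)
  have h6 : r * c ^ (r - 1) * c = r * c ^ r := by rw [mul_assoc, h3]
  nlinarith

theorem isCompactOperator_rpow {B : H →L[ℂ] H} (hB : 0 ≤ B) (hc : IsCompactOperator B) {r : ℝ}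
    (hr : 1 ≤ r) : IsCompactOperator (B ^ r) := by
  have h : B ^ (r - 1) * B = B ^ r := by
    nth_rw 2 [← CFC.rpow_one B]
    rw [rpow_mul_rpow (by linarith) zero_le_one, sub_add_cancel]
  rw [← h]
  exact hc.clm_comp (B ^ (r - 1))

end CompactSpectral

/-! ### Exponents r ≥ 1: min-max comparison and superadditivity up to partial isometries. -/

section Superadditivity

variable {H : Type*} [NormedAddCommGroup H] [InnerProductSpace ℂ H] [CompleteSpace H]

/-- Counting step of the min-max principle. -/
theorem card_le_of_rpow_le {B M : H →L[ℂ] H} (hB : IsSelfAdjoint B) (hM : IsSelfAdjoint M)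
    {r : ℝ} (hr : 0 < r)
    (h : ∀ x, ‖x‖ = 1 → B.reApplyInnerSelf x ^ r ≤ M.reApplyInnerSelf x)
    {κ ι : Type*} (f : HilbertBasis κ ℂ H) {β : κ → ℝ} (hβ : ∀ k, B (f k) = (β k : ℂ) • f k)
    (e : HilbertBasis ι ℂ H) {μ : ι → ℝ} (hμ : ∀ i, M (e i) = (μ i : ℂ) • e i)
    {c : ℝ} (hc : 0 ≤ c) (S : Finset κ) (hS : ∀ k ∈ S, c ≤ β k) (R : Finset ι)
    (hR : ∀ i, i ∉ R → μ i < c ^ r) : S.card ≤ R.card := by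
  classical
  by_contra! hlt
  -- If |R| < |S|, some nonzero vector in the span of the f_k, k ∈ S, is orthogonal to every e_i, i
  -- ∈ R. Normalized to y, it satisfies ⟨By, y⟩ ≥ c and ⟨My, y⟩ < c^r, a contradiction.
  let L : (S → ℂ) →ₗ[ℂ] (R → ℂ) :=
    LinearMap.pi fun i => (innerSL ℂ (e i) : H →ₗ[ℂ] ℂ) ∘ₗ
      Fintype.linearCombination ℂ (fun k : S => f k)
  have hker : LinearMap.ker L ≠ ⊥ := LinearMap.ker_ne_bot_of_finrank_lt (by simpa using hlt)
  obtain ⟨a, ha, ha0⟩ := (Submodule.ne_bot_iff _).1 hker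
  obtain ⟨x, hx⟩ : ∃ x : H, x = Fintype.linearCombination ℂ (fun k : S => f k) a := ⟨_, rfl⟩
  have hx0 : x ≠ 0 := by
    intro h0
    refine ha0 ?_
    have hli : LinearIndependent ℂ (fun k : S => f k) :=
      f.orthonormal.linearIndependent.comp _ Subtype.val_injective
    rw [h0, Fintype.linearCombination_apply] at hx
    funext k
    exact Fintype.linearIndependent_iff.1 hli a hx.symm k
  have hxR : ∀ i ∈ R, inner ℂ (e i) x = 0 := fun i hi => by
    have := congrFun (LinearMap.mem_ker.1 ha) ⟨i, hi⟩
    rw [hx]; exact this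
  have hxS : ∀ k, k ∉ S → inner ℂ (f k) x = 0 := fun k hk => by
    rw [hx, Fintype.linearCombination_apply, inner_sum]
    refine Finset.sum_eq_zero fun j _ => ?_
    have hkj : k ≠ j := fun hkj => hk (hkj ▸ j.2)
    rw [inner_smul_right, f.orthonormal.2 hkj, mul_zero]
  obtain ⟨y, hy⟩ : ∃ y : H, y = ((‖x‖⁻¹ : ℝ) : ℂ) • x := ⟨_, rfl⟩
  have hy1 : ‖y‖ = 1 := by
    rw [hy, norm_smul, Complex.norm_real, norm_inv, norm_norm,
      inv_mul_cancel₀ (norm_ne_zero_iff.2 hx0)]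
  have hyR : ∀ i ∈ R, inner ℂ (e i) y = 0 := fun i hi => by
    rw [hy, inner_smul_right, hxR i hi, mul_zero]
  have hyS : ∀ k, k ∉ S → inner ℂ (f k) y = 0 := fun k hk => by
    rw [hy, inner_smul_right, hxS k hk, mul_zero]
  have h1 : c ≤ B.reApplyInnerSelf y := by
    have s1 := (hasSum_norm_inner_sq f y).mul_left c
    rw [hy1, one_pow, mul_one] at s1
    refine hasSum_le (fun k => ?_) s1 (hasSum_reApplyInnerSelf hB f hβ y)
    by_cases hk : k ∈ S
    · exact mul_le_mul_of_nonneg_right (hS k hk) (sq_nonneg _)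
    · simp [hyS k hk]
  have h2 : M.reApplyInnerSelf y < c ^ r := by
    have s1 := (hasSum_norm_inner_sq e y).mul_left (c ^ r)
    rw [hy1, one_pow, mul_one] at s1
    have hle : ∀ i, μ i * ‖inner ℂ (e i) y‖ ^ 2 ≤ c ^ r * ‖inner ℂ (e i) y‖ ^ 2 := fun i => by
      by_cases hi : i ∈ R
      · simp [hyR i hi]
      · exact mul_le_mul_of_nonneg_right (hR i hi).le (sq_nonneg _)
    obtain ⟨i, hi⟩ : ∃ i, inner ℂ (e i) y ≠ 0 := by
      by_contra! hall
      have := hasSum_norm_inner_sq e y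
      simp only [hall, norm_zero, ne_eq, OfNat.ofNat_ne_zero, not_false_eq_true, zero_pow] at this
      have := this.unique hasSum_zero
      rw [hy1] at this
      norm_num at this
    refine hasSum_lt (i := i) hle ?_ (hasSum_reApplyInnerSelf hM e hμ y) s1
    have hiR : i ∉ R := fun hiR => hi (hyR i hiR)
    have : 0 < ‖inner ℂ (e i) y‖ := norm_pos_iff.2 hi
    exact mul_lt_mul_of_pos_right (hR i hiR) (by positivity)
  have h3 : c ^ r ≤ B.reApplyInnerSelf y ^ r := Real.rpow_le_rpow hc h1 hr.le
  linarith [h y hy1]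

/-- If `⟨B x, x⟩ ^ r ≤ ⟨M x, x⟩` on the unit sphere, then `B ^ r` is dominated by `M` up to a
partial isometry with initial space `(ker B)ᗮ`. -/
theorem exists_partialIsometry_conj_rpow_le {B M : H →L[ℂ] H} (hB : 0 ≤ B)
    (hBc : IsCompactOperator B) (hM : 0 ≤ M) (hMc : IsCompactOperator M) {r : ℝ} (hr : 0 < r)
    (h : ∀ x, ‖x‖ = 1 → B.reApplyInnerSelf x ^ r ≤ M.reApplyInnerSelf x) :
    ∃ V : H →L[ℂ] H, IsPartialIsometryOp V ∧ (∀ x, V x = 0 ↔ B x = 0) ∧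
      V * B ^ r * star V ≤ M := by
  classical
  obtain ⟨κ, f, β, hβ0, hβ, -⟩ := exists_eigenbasis hB hBc
  obtain ⟨ι, e, μ, hμ0, hμ, hfin⟩ := exists_eigenbasis hM hMc
  let J := {k : κ // 0 < β k}
  have hfin' : ∀ j : J, {i | β j.1 ^ r ≤ μ i}.Finite := fun j =>
    hfin _ (Real.rpow_pos_of_pos j.2 r)
  -- Hall's marriage theorem matches each positive eigenvalue of B injectively with a sufficiently
  -- large one of M, without ordering either spectrum. Hall's condition for S follows from the count
  -- at its smallest eigenvalue.
  obtain ⟨σ, hσ, hσμ⟩ := (Finset.all_card_le_biUnion_card_iff_exists_injective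
    (fun j : J => (hfin' j).toFinset)).1 (by
      intro S
      rcases S.eq_empty_or_nonempty with rfl | hne
      · simp
      obtain ⟨j₀, hj₀, hmin⟩ := S.exists_min_image (fun j => β j.1) hne
      calc S.card = (S.map (Function.Embedding.subtype _)).card := (Finset.card_map _).symm
        _ ≤ ((hfin' j₀).toFinset).card := by
          refine card_le_of_rpow_le hB.isSelfAdjoint hM.isSelfAdjoint hr h f hβ e hμ
            j₀.2.le _ (fun k hk => ?_) _ (fun i hi => ?_)
          · obtain ⟨j, hj, rfl⟩ := Finset.mem_map.1 hk
            exact hmin j hj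
          · simpa using hi
        _ ≤ _ := Finset.card_le_card (Finset.subset_biUnion_of_mem
            (fun j : J => (hfin' j).toFinset) hj₀))
  have hσμ : ∀ j : J, β j.1 ^ r ≤ μ (σ j) := fun j => by simpa using hσμ j
  obtain ⟨V, hV, hVf, hV0⟩ := exists_partialIsometry_of_orthonormal
    (f.orthonormal.comp (Subtype.val : J → κ) Subtype.val_injective) (e.orthonormal.comp σ hσ)
  have hzero : ∀ k, ¬ 0 < β k → β k = 0 := fun k hk => le_antisymm (not_lt.1 hk) (hβ0 k)
  have hVfz : ∀ k, ¬ 0 < β k → V (f k) = 0 := fun k hk => (hV0 _).2 fun j =>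
    f.orthonormal.2 fun hjk => hk (hjk ▸ j.2)
  refine ⟨V, hV, fun x => ?_, ?_⟩
  · rw [hV0]
    constructor
    · intro hx
      refine apply_eq_zero_of_reApplyInnerSelf_eq_zero hB ?_
      refine (hasSum_reApplyInnerSelf hB.isSelfAdjoint f hβ x).unique ?_
      convert hasSum_zero using 2 with k
      by_cases hk : 0 < β k
      · have := hx ⟨k, hk⟩
        simp only [Function.comp_apply] at this
        simp [this]
      · simp [hzero k hk]
    · intro hx j
      have h1 := hB.isSelfAdjoint.isSymmetric (f j.1) x
      simp only [coe_coe] at h1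
      rw [hβ, hx, inner_zero_right, inner_smul_left] at h1
      simpa [j.2.ne'] using h1
  · have hBr : 0 ≤ B ^ r := CFC.rpow_nonneg
    refine le_of_reApplyInnerSelf_le (hBr.isSelfAdjoint.conjugate V) hM.isSelfAdjoint fun y => ?_
    rw [reApplyInnerSelf_conj]
    have h1 : ∀ k, inner ℂ (f k) (star V y) = inner ℂ (V (f k)) y := fun k =>
      adjoint_inner_right V (f k) y
    have s1 := hasSum_reApplyInnerSelf hBr.isSelfAdjoint f
      (fun k => rpow_apply_eigenvector hB (hβ k) hr.le) (star V y)
    have hsupp : Function.support (fun k => β k ^ r * ‖inner ℂ (f k) (star V y)‖ ^ 2) ⊆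
        {k | 0 < β k} := fun k hk => by
      by_contra hk0
      refine hk ?_
      simp only
      rw [h1, hVfz k hk0]
      simp
    have s2 := (hasSum_subtype_iff_of_support_subset hsupp).2 s1
    refine hasSum_le_inj σ hσ (fun i _ => mul_nonneg (hμ0 i) (sq_nonneg _)) (fun j => ?_) s2
      (hasSum_reApplyInnerSelf hM.isSelfAdjoint e hμ y)
    simp only [Function.comp_apply]
    rw [h1, show V (f j.1) = e (σ j) from hVf j]
    exact mul_le_mul_of_nonneg_right (hσμ j) (sq_nonneg _)

/-- A partial isometry `V` with `ker V = ker D` and `V D V* ≤ G` may be followed by any partial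
isometry whose kernel lies in `ker G`. -/
theorem partialIsometry_comp {V N D G : H →L[ℂ] H} (hV : IsPartialIsometryOp V)
    (hVD : ∀ x, V x = 0 ↔ D x = 0) (hD : 0 ≤ D) (hle : V * D * star V ≤ G)
    (hN : IsPartialIsometryOp N) (hNG : ∀ x, N x = 0 → G x = 0) :
    IsPartialIsometryOp (N * V) ∧ ∀ x, (N * V) x = 0 ↔ D x = 0 := by
  have hV' : star V * V * star V = star V := by
    have := congrArg star hV
    simpa [mul_assoc] using this
  -- Thus V* kills ker G, which contains ker N; so V has its range in the initial space of N.
  have hGV : ∀ x, G x = 0 → star V x = 0 := fun x hx => by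
    have h1 := apply_eq_zero_of_le (star_right_conjugate_nonneg hD V) hle hx
    have h2 : D.reApplyInnerSelf (star V x) = 0 := by
      rw [← reApplyInnerSelf_conj, reApplyInnerSelf_apply, h1, inner_zero_left, map_zero]
    have h3 := (hVD _).2 (apply_eq_zero_of_reApplyInnerSelf_eq_zero hD h2)
    rw [← hV', mul_assoc]
    change star V (V (star V x)) = 0
    rw [h3, map_zero]
  have hNN : star N * N * V = V := by
    have h1 : star V * (1 - star N * N) = 0 := by
      ext x
      refine hGV _ (hNG _ ?_)
      have : N * (1 - star N * N) = 0 := by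
        rw [mul_sub, mul_one, ← mul_assoc, hN, sub_self]
      exact congr($this x)
    have h2 := congrArg star h1
    rw [star_mul, star_star, star_sub, star_one, star_mul, star_star, star_zero, sub_mul, one_mul,
      sub_eq_zero] at h2
    exact h2.symm
  refine ⟨?_, fun x => ?_⟩
  · calc N * V * star (N * V) * (N * V) = N * (V * star V * (star N * N * V)) := by
          rw [star_mul]; simp only [mul_assoc]
      _ = N * V := by rw [hNN, hV]
  · rw [← hVD]
    constructor
    · intro hx
      rw [← hNN, mul_assoc]
      change star N ((N * V) x) = 0
      rw [hx, map_zero]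
    · intro hx
      rw [mul_apply_eq, hx, map_zero]

/-- Superadditivity of `x ↦ x ^ r`, `r ≥ 1`, up to conjugation by partial isometries, with the
`r`-th power of the sum replaced by any `M` dominating it spectrally. -/
theorem exists_partialIsometries_sum_rpow_le {ι : Type*} [Fintype ι] {A : ι → H →L[ℂ] H}
    (hA : ∀ i, 0 ≤ A i) (hAc : ∀ i, IsCompactOperator (A i)) {M : H →L[ℂ] H} (hM : 0 ≤ M)
    (hMc : IsCompactOperator M) {r : ℝ} (hr : 1 ≤ r)
    (h : ∀ x, ‖x‖ = 1 → (∑ i, A i).reApplyInnerSelf x ^ r ≤ M.reApplyInnerSelf x) :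
    ∃ U : ι → H →L[ℂ] H, (∀ i, IsPartialIsometryOp (U i)) ∧ (∀ i x, U i x = 0 ↔ A i x = 0) ∧
      ∑ i, U i * A i ^ r * star (U i) ≤ M := by
  have hr0 : 0 < r := by linarith
  obtain ⟨S, hS⟩ : ∃ S, S = ∑ i, A i := ⟨_, rfl⟩
  rw [← hS] at h
  have hS0 : 0 ≤ S := hS ▸ Finset.sum_nonneg fun i _ => hA i
  have hSc : IsCompactOperator S := by
    rw [hS]
    exact Submodule.sum_mem (compactOperator (RingHom.id ℂ) H H) fun i _ => hAc i
  have hSr : 0 ≤ S ^ r := CFC.rpow_nonneg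
  have hSrc := isCompactOperator_rpow hS0 hSc hr
  have hAr : ∀ i, 0 ≤ A i ^ r := fun i => CFC.rpow_nonneg
  have hker : ∀ i x, (A i ^ r) x = 0 ↔ A i x = 0 := fun i x =>
    ⟨apply_eq_zero_of_rpow_apply_eq_zero (hA i) hr0, fun hx => rpow_apply_eq_zero (hA i) hx hr0⟩
  have hsS : ∀ a : ℝ, star (S ^ a) = S ^ a := fun a => (isSelfAdjoint_rpow S a).star_eq
  obtain ⟨C, hC, hCS, -, hsum⟩ := exists_contractions_of_sum hA hS.symm
  obtain ⟨W, hW, hWS, hWM⟩ := exists_partialIsometry_conj_rpow_le hS0 hSc hM hMc hr0 h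
  have hCSC : ∀ i, C i * S * star (C i) = A i := fun i => by
    have h1 := congrArg star (hCS i)
    rw [star_mul, hsS, (isSelfAdjoint_rpow (A i) _).star_eq] at h1
    rw [← half_mul_half hS0, ← half_mul_half (hA i)]
    nth_rw 1 [← hCS i]
    rw [← h1]
    simp only [mul_assoc]
  let T : ι → H →L[ℂ] H := fun i => S ^ (r / 2) * star (C i)
  have hT : ∀ i, star (T i) * T i = C i * S ^ r * star (C i) := fun i => by
    have : S ^ (r / 2) * S ^ (r / 2) = S ^ r := by
      rw [rpow_mul_rpow (by positivity) (by positivity)]; ring_nf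
    simp only [T, star_mul, star_star, hsS]
    rw [← this]; simp only [mul_assoc]
  have hstep : ∀ i, ∃ U : H →L[ℂ] H, IsPartialIsometryOp U ∧ (∀ x, U x = 0 ↔ A i x = 0) ∧
      U * A i ^ r * star U ≤ W * (T i * star (T i)) * star W := by
    intro i
    -- Substitute for Hansen's inequality: A_i = C_i S C_i*, so the scalar estimate for S at y =
    -- C_i* x compares A_i with C_i S^r C_i*.
    obtain ⟨V, hV, hVA, hVT⟩ := exists_partialIsometry_conj_rpow_le (hA i) (hAc i)
      (M := star (T i) * T i) (star_mul_self_nonneg _)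
      (by rw [hT]; exact (hSrc.comp_clm (star (C i))).clm_comp (C i)) hr0 (fun x hx => by
        rw [hT, reApplyInnerSelf_conj, ← hCSC i, reApplyInnerSelf_conj]
        exact rpow_reApplyInnerSelf_le hS0 hr ((star_contraction (hC i) x).trans hx.le))
    obtain ⟨N, hNT, hN, -, hNP⟩ := exists_polar (T i)
    have hs : star (CFC.abs (T i)) = CFC.abs (T i) := (CFC.abs_nonneg (T i)).isSelfAdjoint.star_eq
    have hNconj : N * (star (T i) * T i) * star N = T i * star (T i) := by
      calc N * (star (T i) * T i) * star N
          = (N * CFC.abs (T i)) * star (N * CFC.abs (T i)) := by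
            rw [← CFC.abs_mul_abs, star_mul, hs]; simp only [mul_assoc]
        _ = T i * star (T i) := by rw [hNT]
    have hNker : ∀ x, N x = 0 → (star (T i) * T i) x = 0 := fun x hx => by
      have h1 : CFC.abs (T i) * star N * N = CFC.abs (T i) := by
        have := congrArg star hNP
        rwa [star_mul, hs, star_mul, star_star, ← mul_assoc] at this
      rw [← CFC.abs_mul_abs, mul_apply_eq]
      nth_rw 2 [← h1]
      rw [mul_apply_eq, hx, map_zero, map_zero]
    obtain ⟨hP, hP0⟩ := partialIsometry_comp hV (fun x => (hVA x).trans (hker i x).symm) (hAr i)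
      hVT hN hNker
    have hle : N * V * A i ^ r * star (N * V) ≤ T i * star (T i) := by
      rw [← hNconj]
      convert star_right_conjugate_le_conjugate hVT N using 1
      rw [star_mul]; simp only [mul_assoc]
    -- Domination by S^r is what allows composition with W, whose kernel is ker S.
    have hle' : T i * star (T i) ≤ S ^ r := by
      rw [← hsum r hr0]
      have : ∀ j, S ^ (r / 2) * star (C j) * (C j * S ^ (r / 2)) = T j * star (T j) := fun j => by
        simp only [T, star_mul, star_star, hsS]
      simp only [this]
      exact Finset.single_le_sum (f := fun j => T j * star (T j))
        (fun j _ => mul_star_self_nonneg _) (Finset.mem_univ i)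
    obtain ⟨hQ, hQ0⟩ := partialIsometry_comp hP hP0 (hAr i) (hle.trans hle') hW
      (fun x hx => rpow_apply_eq_zero hS0 ((hWS x).1 hx) hr0)
    refine ⟨W * (N * V), hQ, fun x => (hQ0 x).trans (hker i x), ?_⟩
    convert star_right_conjugate_le_conjugate hle W using 1
    rw [star_mul W]; simp only [mul_assoc]
  choose U hU hUA hUle using hstep
  refine ⟨U, hU, hUA, ?_⟩
  calc ∑ i, U i * A i ^ r * star (U i) ≤ ∑ i, W * (T i * star (T i)) * star W :=
        Finset.sum_le_sum fun i _ => hUle i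
    _ = W * S ^ r * star W := by
        rw [← hsum r hr0, Finset.mul_sum, Finset.sum_mul]
        simp only [T, star_mul, star_star, hsS]
    _ ≤ M := hWM

/-- In finite dimension the partial isometry `U` may be replaced by a unitary. -/
theorem exists_isometry_conj_eq_of_finiteDimensional [FiniteDimensional ℂ H] {U D : H →L[ℂ] H}
    (hU : IsPartialIsometryOp U) (hD : IsSelfAdjoint D) (hUD : ∀ x, U x = 0 → D x = 0) :
    ∃ U' : H →L[ℂ] H, IsIsometryOp U' ∧ U' * D * star U' = U * D * star U := by
  obtain ⟨Q, hQ⟩ : ∃ Q, Q = star U * U := ⟨_, rfl⟩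
  have hUQ : U * Q = U := by rw [hQ, ← mul_assoc]; exact hU
  have hQQ : star Q * Q = star U * U := by
    rw [hQ, star_mul, star_star, ← hQ, hQ, ← mul_assoc, mul_assoc (star U) U (star U), mul_assoc,
      hU]
  let S := LinearMap.range (Q : H →ₗ[ℂ] H)
  let L : S →ₗᵢ[ℂ] H := ⟨(U : H →ₗ[ℂ] H).domRestrict S, by
    rintro ⟨_, ⟨x, rfl⟩⟩
    change ‖(U * Q) x‖ = ‖Q x‖
    rw [hUQ]
    exact norm_eq_of_star_mul_self_eq hQQ.symm x⟩
  let U' : H →L[ℂ] H := L.extend.toContinuousLinearMap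
  have hU'Q : U' * Q = U := by
    ext x
    refine (L.extend_apply ⟨Q x, ⟨x, rfl⟩⟩).trans ?_
    change (U * Q) x = U x
    rw [hUQ]
  -- D lives on the initial space of U, so how U is extended off that space does not affect the
  -- conjugate of D.
  have hDQ : D * Q = D := by
    have h1 : D * (1 - Q) = 0 := by
      ext x
      refine hUD _ ?_
      have : U * (1 - Q) = 0 := by rw [mul_sub, mul_one, hUQ, sub_self]
      exact congr($this x)
    rw [mul_sub, mul_one, sub_eq_zero] at h1
    exact h1.symm
  have hQs : star Q = Q := by rw [hQ, star_mul, star_star]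
  have hQD : Q * D = D := by
    have := congrArg star hDQ
    rwa [star_mul, hQs, hD.star_eq] at this
  refine ⟨U', (norm_map_iff_adjoint_comp_self U').1 L.extend.norm_map, ?_⟩
  calc U' * D * star U' = U' * (Q * D * Q) * star U' := by rw [hQD, hDQ]
    _ = (U' * Q) * D * star (U' * Q) := by rw [star_mul, hQs]; simp only [mul_assoc]
    _ = U * D * star U := by rw [hU'Q]

end Superadditivity

/-! ### The two halves of the theorem. -/

section Main

variable {H : Type*} [NormedAddCommGroup H] [InnerProductSpace ℂ H] [CompleteSpace H]

theorem absPow_eq (X : H →L[ℂ] H) {p : ℝ} (hp : 0 < p) :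
    absPow X p = (star X * X) ^ (p / 2) := by
  rw [absPow, CFC.abs, CFC.sqrt_eq_rpow,
    CFC.rpow_rpow_of_exponent_nonneg _ _ _ (by norm_num) hp.le (star_mul_self_nonneg X)]
  ring_nf

theorem exists_isometricOnSupport_sum_le {s t : ℕ} {p : ℝ} (hp : 2 ≤ p)
    {X : Fin s → H →L[ℂ] H} {Y : Fin t → H →L[ℂ] H} (hX : ∀ i, IsCompactOperator (X i))
    (hY : ∀ j, IsCompactOperator (Y j))
    (hXY : ∑ i, star (X i) * X i = ∑ j, star (Y j) * Y j) :
    ∃ U : Fin s → H →L[ℂ] H, (∀ i, IsIsometricOnSupport (U i) (X i)) ∧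
      ∑ i, U i * absPow (X i) p * star (U i) ≤ ((t : ℝ) ^ (p / 2 - 1)) • ∑ j, absPow (Y j) p := by
  have hr : 1 ≤ p / 2 := by linarith
  have hp0 : 0 < p := by linarith
  simp only [absPow_eq _ hp0]
  have hA : ∀ i, 0 ≤ star (X i) * X i := fun i => star_mul_self_nonneg (X i)
  have hB : ∀ j, 0 ≤ star (Y j) * Y j := fun j => star_mul_self_nonneg (Y j)
  have hBc : ∀ j, IsCompactOperator ((star (Y j) * Y j) ^ (p / 2)) := fun j =>
    isCompactOperator_rpow (hB j) ((hY j).clm_comp (star (Y j))) hr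
  have hM : (0 : H →L[ℂ] H) ≤ ((t : ℝ) ^ (p / 2 - 1)) • ∑ j, (star (Y j) * Y j) ^ (p / 2) :=
    smul_nonneg (by positivity) (Finset.sum_nonneg fun j _ => CFC.rpow_nonneg)
  have hMc : IsCompactOperator
      (((t : ℝ) ^ (p / 2 - 1)) • ∑ j, (star (Y j) * Y j) ^ (p / 2) : H →L[ℂ] H) := by
    refine IsCompactOperator.smul ?_ _
    exact Submodule.sum_mem (compactOperator (RingHom.id ℂ) H H) fun j _ => hBc j
  obtain ⟨U, hU, hUX, hle⟩ := exists_partialIsometries_sum_rpow_le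
    (A := fun i => star (X i) * X i) hA
    (fun i => (hX i).clm_comp (star (X i))) hM hMc hr (fun x hx => by
      rw [hXY, reApplyInnerSelf_sum, reApplyInnerSelf_real_smul, reApplyInnerSelf_sum]
      -- The scalar power-mean inequality for t terms is the source of t^(p/2-1).
      refine (Real.rpow_sum_le_const_mul_sum_rpow_of_nonneg Finset.univ hr fun j _ =>
        reApplyInnerSelf_nonneg (hB j) x).trans ?_
      rw [Finset.card_univ, Fintype.card_fin]
      refine mul_le_mul_of_nonneg_left (Finset.sum_le_sum fun j _ => ?_) (by positivity)
      exact rpow_reApplyInnerSelf_le (hB j) hr hx.le)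
  have hker : ∀ i x, U i x = 0 → X i x = 0 := fun i x hx => by
    have h1 := reApplyInnerSelf_star_mul_self (X i) x
    rw [reApplyInnerSelf_apply, (hUX i x).1 hx, inner_zero_left, map_zero] at h1
    simpa using h1.symm
  by_cases hfin : FiniteDimensional ℂ H
  · choose U' hU' hconj using fun i => exists_isometry_conj_eq_of_finiteDimensional (hU i)
      (isSelfAdjoint_rpow (star (X i) * X i) (p / 2)) (fun x hx =>
        rpow_apply_eq_zero (hA i) ((hUX i x).1 hx) (by positivity))
    refine ⟨U', fun i => ⟨?_, fun x hx => ?_, fun _ => hU' i⟩, ?_⟩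
    · have h1 : star (U' i) * U' i = 1 := hU' i
      rw [IsPartialIsometryOp, mul_assoc, h1, mul_one]
    · have h1 : U' i x = 0 := hx
      have h2 : (star (U' i) * U' i) x = x := congr($(hU' i) x)
      rw [mul_apply_eq, h1, map_zero] at h2
      rw [← h2]; exact zero_mem _
    · simp only [hconj]
      exact hle
  · exact ⟨U, fun i => ⟨hU i, hker i, fun h => absurd h hfin⟩, hle⟩

theorem exists_isometry_sum_ge {s t : ℕ} {p : ℝ} (hp0 : 0 < p) (hp : p ≤ 2)
    {X : Fin s → H →L[ℂ] H} {Y : Fin t → H →L[ℂ] H}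
    (hXY : ∑ i, star (X i) * X i = ∑ j, star (Y j) * Y j) :
    ∃ U : Fin s → H →L[ℂ] H, (∀ i, IsIsometryOp (U i)) ∧
      ((t : ℝ) ^ (p / 2 - 1)) • ∑ j, absPow (Y j) p ≤
        ∑ i, U i * absPow (X i) p * star (U i) := by
  simp only [absPow_eq _ hp0]
  obtain ⟨U, hU, hle⟩ := exists_isometries_sum_rpow_le (A := fun i => star (X i) * X i)
    (fun i => star_mul_self_nonneg _) (r := p / 2) (by positivity) (by linarith)
  refine ⟨U, hU, le_trans ?_ hle⟩
  rw [hXY]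
  exact card_rpow_smul_sum_rpow_le (fun j => star_mul_self_nonneg _) (by positivity) (by linarith)

end Main

theorem theorem1p7 {H : Type*} [NormedAddCommGroup H] [InnerProductSpace ℂ H] [CompleteSpace H]
    (p : ℝ) (hp : 0 < p) (s t : ℕ) (X : Fin s → (H →L[ℂ] H)) (Y : Fin t → (H →L[ℂ] H))
    (hX : ∀ i, IsSchatten p (X i)) (hY : ∀ j, IsSchatten p (Y j))
    (hXY : ∑ i, CFC.abs (X i) ^ 2 = ∑ j, CFC.abs (Y j) ^ 2) :
    (2 ≤ p →
      (∃ U : Fin s → (H →L[ℂ] H), (∀ i, IsIsometricOnSupport (U i) (X i)) ∧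
        ∑ i, U i * absPow (X i) p * star (U i) ≤
          ((t : ℝ) ^ (p / 2 - 1)) • ∑ j, absPow (Y j) p) ∧
      (∃ V : Fin t → (H →L[ℂ] H), (∀ j, IsIsometricOnSupport (V j) (Y j)) ∧
        ∑ j, V j * absPow (Y j) p * star (V j) ≤
          ((s : ℝ) ^ (p / 2 - 1)) • ∑ i, absPow (X i) p)) ∧
    (p ≤ 2 →
      (∃ U : Fin s → (H →L[ℂ] H), (∀ i, IsIsometryOp (U i)) ∧
        ((t : ℝ) ^ (p / 2 - 1)) • ∑ j, absPow (Y j) p ≤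
          ∑ i, U i * absPow (X i) p * star (U i)) ∧
      (∃ V : Fin t → (H →L[ℂ] H), (∀ j, IsIsometryOp (V j)) ∧
        ((s : ℝ) ^ (p / 2 - 1)) • ∑ i, absPow (X i) p ≤
          ∑ j, V j * absPow (Y j) p * star (V j))) := by
  simp only [sq, CFC.abs_mul_abs] at hXY
  exact ⟨fun h => ⟨exists_isometricOnSupport_sum_le h (fun i => (hX i).1) (fun j => (hY j).1) hXY,
      exists_isometricOnSupport_sum_le h (fun j => (hY j).1) (fun i => (hX i).1) hXY.symm⟩,
    fun h => ⟨exists_isometry_sum_ge hp h hXY, exists_isometry_sum_ge hp h hXY.symm⟩⟩
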